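/- For real $\mu,\nu$ such that neither $\mu+\nu$ nor $\mu-\nu$ is an odd negative integer, let $$s_{\mu,\nu}(z)=z^{\mu+1}\sum_{n\ge 0}\frac{(-1)^n z^{2n}}{\prod_{j=0}^{n}\left((\mu+2j+1)^2-\nu^2\right)}$$ be the Lommel function, and let $$a_{\mu,\nu}=2\,\frac{\Gamma\left(\frac{\mu+1+\nu}{2}\right)\Gamma\left(\frac{\mu+1-\nu}{2}\right)}{\Gamma\left(\frac{\mu+\nu}{2}\right)\Gamma\left(\frac{\mu-\nu}{2}\right)}.$$ Let $\mu\in(-1/2,1/2)$, $|\nu|\in(|\mu|,\mu+1)$ and $\theta\in[0,\pi]$. Then the function $$F(z)=z^{-\mu}\left(a_{\mu,\nu}\cos\theta\; s_{\mu-1,\nu}(z)+\sin\theta\; s_{\mu,\nu}(z)\right),\qquad z\neq 0,$$ (the same branch being used in all the powers of $z$) extends to an entire function, again denoted by $F$, and this entire function has only real zeros, all of them simple. For $k\in\mathbb{Z}$ let $$I_k=\left(\left(k-\tfrac12\right)\pi+\theta,\ \left(k+\tfrac12\right)\pi+\theta\right).$$ Every zero of $F$ other than $z=0$ lies in one of the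 intervals $I_k$, and $F(0)=0$ if and only if $\theta=\pi/2$. Each $I_k$ whose closure does not contain $0$ contains exactly one zero of $F$; an interval $I_k$ whose closure contains $0$ contains no zero of $F$. -/

import Mathlib

noncomputable section

/-- The Lommel function `s_{μ,ν}(z)` through its series at the origin
`z^{μ+1}/((μ+1)²-ν²) · (1 - z²/((μ+3)²-ν²) + z⁴/(((μ+3)²-ν²)((μ+5)²-ν²)) - ⋯)`,
with the principal branch of `z^{μ+1}`; meaningful for `z ≠ 0` when neither `μ + ν` nor `μ - ν` is
an odd negative integer (then no factor in a denominator vanishes, and the series converges for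
every `z`). -/
def lommelS (μ ν : ℝ) (z : ℂ) : ℂ :=
  z ^ ((μ : ℂ) + 1) *
    ∑' n : ℕ, (-1) ^ n * z ^ (2 * n) /
      ∏ j ∈ Finset.range (n + 1), (((μ : ℂ) + 2 * (j : ℂ) + 1) ^ 2 - (ν : ℂ) ^ 2)

/-- The constant `a_{μ,ν} = 2 Γ((μ+1+ν)/2) Γ((μ+1-ν)/2) / (Γ((μ+ν)/2) Γ((μ-ν)/2))`. -/
def lommelA (μ ν : ℝ) : ℝ :=
  2 * (Real.Gamma ((μ + 1 + ν) / 2) * Real.Gamma ((μ + 1 - ν) / 2)) /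
    (Real.Gamma ((μ + ν) / 2) * Real.Gamma ((μ - ν) / 2))

/-- The combination `z^{-μ} (a_{μ,ν} cos θ · s_{μ-1,ν}(z) + sin θ · s_{μ,ν}(z))`, for `z ≠ 0`. -/
def lommelComb (μ ν θ : ℝ) (z : ℂ) : ℂ :=
  z ^ (-(μ : ℂ)) *
    (((lommelA μ ν * Real.cos θ : ℝ) : ℂ) * lommelS (μ - 1) ν z +
      ((Real.sin θ : ℝ) : ℂ) * lommelS μ ν z)

/-- The left end point `(k - 1/2)π + θ` of the `k`-th interval; the right one is that of `k + 1`. -/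
def zeroEndpoint (θ : ℝ) (k : ℤ) : ℝ := ((k : ℝ) - 1 / 2) * Real.pi + θ

end

/-! The combination is a cosine transform: `F(z) = ∫₀¹ f(t) cos(zt - θ) dt`, where `f = lommelWeight
μ |ν|` is an explicit positive increasing weight. The even and odd moments of `f` reproduce the
series of `a_{μ,ν} s_{μ-1,ν}` and `s_{μ,ν}` (`lommelWeight_moment_even`, `lommelWeight_moment_odd`).
The integral is entire, so it supplies the extension.

The zeros are then governed by monotonicity of `f` alone. Put `L(w) = ∫₀¹ f(t) e^{wt} dt`, so that
`2F(z) = e^{-iθ} L(iz) + e^{iθ} L(-iz)`. Two facts carry the argument.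

(1) `Re(w e^{-w} L(w)) > 0` for `Re w ≥ 0`, `w ≠ 0` (`mul_meanDefect_le`, `meanDefect_pos`). Hence
`L` has no zero in the closed right half-plane, and on the imaginary axis the phase of `L(ix)` is
confined to a half-plane (`phase`).

(2) `|L(-w)| e^{Re w} ≤ |L(w)|` for `Re w ≥ 0`, by Phragmén-Lindelöf
(`norm_expTransform_neg_mul_exp_le`). Strictness off the axis makes the zeros of `F` real.
Differentiated across the axis, the inequality says that the argument of `L(ix)` grows at rate at
least `1/2` (`normSq_le_re_conj_mul_deriv`), which makes the zeros simple.

Together, `x cos(x - θ) F'(x) > 0` at every real zero `x ≠ 0`, while (1) gives the sign of `F`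
wherever `cos(x - θ) = 0`, that is, at the end points of the `I_k`. So on an `I_k` whose closure
avoids `0`, `F` changes sign and crosses zero in one direction only: there is exactly one zero. If
the closure of `I_k` contains `0`, the integrand has constant sign. -/

section

open MeasureTheory Set

/-! ### Integration against increasing functions -/

/-- A final segment of `(0, 1)` is, up to a null set, an open interval `(s, 1)`. -/
lemma exists_ae_eq_Ioo_of_upward_closed {S : Set ℝ} (hS : S ⊆ Ioo 0 1) (hne : S.Nonempty)
    (hup : ∀ x ∈ S, ∀ y ∈ Ioo (0 : ℝ) 1, x ≤ y → y ∈ S) :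
    ∃ s ∈ Icc (0 : ℝ) 1, S =ᵐ[volume] Ioo s 1 := by
  have hbdd : BddBelow S := ⟨0, fun x hx => (hS hx).1.le⟩
  obtain ⟨x₀, hx₀⟩ := hne
  have h0 : 0 ≤ sInf S := le_csInf ⟨x₀, hx₀⟩ fun x hx => (hS hx).1.le
  have h1 : sInf S ≤ 1 := (csInf_le hbdd hx₀).trans (hS hx₀).2.le
  refine ⟨sInf S, ⟨h0, h1⟩, ?_⟩
  have hsub : S ⊆ Ico (sInf S) 1 := fun x hx => ⟨csInf_le hbdd hx, (hS hx).2⟩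
  have hsup : Ioo (sInf S) 1 ⊆ S := by
    intro y hy
    obtain ⟨x, hx, hxy⟩ := exists_lt_of_csInf_lt ⟨x₀, hx₀⟩ hy.1
    exact hup x hx y ⟨h0.trans_lt hy.1, hy.2⟩ hxy.le
  exact (hsub.eventuallyLE.trans Ioo_ae_eq_Ico.symm.le).antisymm hsup.eventuallyLE

/-- If all tail integrals of `g` over `(s, 1)` are nonnegative, so is the integral of `g` against
a nonnegative increasing function. -/
lemma integral_mul_nonneg_of_monotoneOn {h g : ℝ → ℝ} (hm : MonotoneOn h (Ioo 0 1))
    (h0 : ∀ t ∈ Ioo (0 : ℝ) 1, 0 ≤ h t) (hi : IntegrableOn h (Ioo 0 1)) (hg : Continuous g)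
    (hgs : ∀ s ∈ Icc (0 : ℝ) 1, 0 ≤ ∫ t in s..1, g t) :
    0 ≤ ∫ t in Ioo (0 : ℝ) 1, h t * g t := by
  obtain ⟨C, hC⟩ := isCompact_Icc.exists_bound_of_continuousOn (s := Icc (0 : ℝ) 1) hg.continuousOn
  have hC' : ∀ t ∈ Ioo (0 : ℝ) 1, |g t| ≤ C := fun t ht => hC t (Ioo_subset_Icc_self ht)
  have hC0 : 0 ≤ C := (norm_nonneg _).trans (hC 0 ⟨le_rfl, zero_le_one⟩)
  have hae : AEMeasurable h (volume.restrict (Ioo 0 1)) := hi.aemeasurable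
  have hnn : 0 ≤ᵐ[volume.restrict (Ioo 0 1)] h :=
    (ae_restrict_iff' measurableSet_Ioo).2 (.of_forall h0)
  -- Layer-cake argument: superlevel sets of `h` are final segments of `(0, 1)`, on which the
  -- hypothesis compares the densities `C` and `g + C`. Adding the bound `C` makes the second
  -- density nonnegative; integrating over the levels `l` then gives `∫ C h ≤ ∫ (g + C) h`.
  have hset : ∀ l : ℝ, ((volume.restrict (Ioo 0 1)).withDensity fun _ => ENNReal.ofReal C)
      {t | l < h t} ≤ ((volume.restrict (Ioo 0 1)).withDensity
        fun t => ENNReal.ofReal (g t + C)) {t | l < h t} := by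
    intro l
    rw [withDensity_apply', withDensity_apply', Measure.restrict_restrict' measurableSet_Ioo]
    rcases ({t | l < h t} ∩ Ioo 0 1).eq_empty_or_nonempty with he | hne
    · simp [he]
    obtain ⟨s, hs, hse⟩ := exists_ae_eq_Ioo_of_upward_closed inter_subset_right hne
      (fun x hx y hy hxy => ⟨lt_of_lt_of_le hx.1 (hm hx.2 hy hxy), hy⟩)
    rw [Measure.restrict_congr_set hse]
    have hgC : IntegrableOn (fun t => g t + C) (Ioo s 1) :=
      ((hg.add continuous_const).integrableOn_Icc (a := s) (b := 1)).mono_set Ioo_subset_Icc_self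
    rw [← ofReal_integral_eq_lintegral_ofReal hgC]
    · rw [← ofReal_integral_eq_lintegral_ofReal (integrable_const C) (.of_forall fun _ => hC0)]
      refine ENNReal.ofReal_le_ofReal ?_
      rw [← integral_Ioc_eq_integral_Ioo, ← integral_Ioc_eq_integral_Ioo,
        ← intervalIntegral.integral_of_le hs.2, ← intervalIntegral.integral_of_le hs.2,
        intervalIntegral.integral_add (hg.intervalIntegrable _ _) (by simp)]
      linarith [hgs s hs]
    · refine (ae_restrict_iff' measurableSet_Ioo).2 (.of_forall fun t ht => ?_)
      have := abs_le.1 (hC' t ⟨hs.1.trans_lt ht.1, ht.2⟩)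
      simp only [Pi.zero_apply]
      linarith
  have hgm : AEMeasurable (fun t => ENNReal.ofReal (g t + C)) (volume.restrict (Ioo 0 1)) :=
    (hg.add continuous_const).measurable.ennreal_ofReal.aemeasurable
  have hle : ∫⁻ t in Ioo 0 1, ENNReal.ofReal (C * h t) ≤
      ∫⁻ t in Ioo 0 1, ENNReal.ofReal ((g t + C) * h t) := by
    have e1 := lintegral_withDensity_eq_lintegral_mul₀
      (μ := volume.restrict (Ioo (0 : ℝ) 1)) (f := fun _ => ENNReal.ofReal C)
      aemeasurable_const hae.ennreal_ofReal
    have e2 := lintegral_withDensity_eq_lintegral_mul₀ hgm hae.ennreal_ofReal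
    rw [lintegral_eq_lintegral_meas_lt _ (withDensity_absolutelyContinuous _ _ hnn)
      (hae.mono_ac (withDensity_absolutelyContinuous _ _))] at e1 e2
    have e3 : ∫⁻ t in Ioo (0 : ℝ) 1, ENNReal.ofReal (C * h t) =
        ∫⁻ t in Ioo (0 : ℝ) 1, ((fun _ : ℝ => ENNReal.ofReal C) * fun t => ENNReal.ofReal (h t)) t :=
      lintegral_congr fun t => by simp [ENNReal.ofReal_mul hC0]
    have e4 : ∫⁻ t in Ioo (0 : ℝ) 1, ENNReal.ofReal ((g t + C) * h t) = ∫⁻ t in Ioo (0 : ℝ) 1,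
        ((fun t => ENNReal.ofReal (g t + C)) * fun t => ENNReal.ofReal (h t)) t :=
      setLIntegral_congr_fun measurableSet_Ioo fun t ht => by
        simp only [Pi.mul_apply]
        rw [ENNReal.ofReal_mul (by linarith [abs_le.1 (hC' t ht)])]
    rw [e3, e4, ← e1, ← e2]
    exact lintegral_mono hset
  have hgh : IntegrableOn (fun t => (g t + C) * h t) (Ioo 0 1) := by
    refine Integrable.bdd_mul (c := 2 * C) hi
      (hg.add continuous_const).aestronglyMeasurable ?_
    refine (ae_restrict_iff' measurableSet_Ioo).2 (.of_forall fun t ht => ?_)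
    have := abs_le.1 (hC' t ht)
    rw [Real.norm_eq_abs, abs_le]
    constructor <;> linarith
  have hCh : IntegrableOn (fun t => C * h t) (Ioo 0 1) := hi.const_mul C
  have hpos : ∀ t ∈ Ioo (0 : ℝ) 1, 0 ≤ (g t + C) * h t := fun t ht =>
    mul_nonneg (by linarith [abs_le.1 (hC' t ht)]) (h0 t ht)
  rw [← ofReal_integral_eq_lintegral_ofReal hCh ((ae_restrict_iff' measurableSet_Ioo).2
      (.of_forall fun t ht => mul_nonneg hC0 (h0 t ht))),
    ← ofReal_integral_eq_lintegral_ofReal hgh ((ae_restrict_iff' measurableSet_Ioo).2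
      (.of_forall hpos)),
    ENNReal.ofReal_le_ofReal_iff (setIntegral_nonneg measurableSet_Ioo hpos)] at hle
  have : ∫ t in Ioo (0 : ℝ) 1, h t * g t =
      (∫ t in Ioo (0 : ℝ) 1, (g t + C) * h t) - ∫ t in Ioo (0 : ℝ) 1, C * h t := by
    rw [← integral_sub hgh hCh]
    congr 1
    ext t
    ring
  linarith

/-! ### The exponential transform -/

/-- The transform `w ↦ ∫₀¹ f(t) e^{wt} dt`. -/
noncomputable def expTransform (f : ℝ → ℝ) (w : ℂ) : ℂ :=
  ∫ t in Ioo (0 : ℝ) 1, (f t : ℂ) * Complex.exp (w * t)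

/-- An integrable weight on `(0, 1)` that exceeds `c t²` by a nonnegative increasing function. -/
structure IsIncreasingWeight (f : ℝ → ℝ) (c : ℝ) : Prop where
  pos : 0 < c
  integrableOn : IntegrableOn f (Ioo 0 1)
  monotoneOn : MonotoneOn (fun t => f t - c * t ^ 2) (Ioo 0 1)
  le : ∀ t ∈ Ioo (0 : ℝ) 1, c * t ^ 2 ≤ f t

lemma MeasureTheory.IntegrableOn.mul_continuous_Ioo {f g : ℝ → ℝ} (hf : IntegrableOn f (Ioo 0 1))
    (hg : Continuous g) : IntegrableOn (fun t => f t * g t) (Ioo 0 1) := by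
  obtain ⟨C, hC⟩ := isCompact_Icc.exists_bound_of_continuousOn (s := Icc (0 : ℝ) 1) hg.continuousOn
  refine Integrable.mul_bdd (c := C) hf hg.aestronglyMeasurable ?_
  exact (ae_restrict_iff' measurableSet_Ioo).2
    (.of_forall fun t ht => hC t (Ioo_subset_Icc_self ht))

lemma MeasureTheory.IntegrableOn.ofReal_mul_continuous_Ioo {f : ℝ → ℝ} {g : ℝ → ℂ}
    (hf : IntegrableOn f (Ioo 0 1)) (hg : Continuous g) :
    IntegrableOn (fun t => (f t : ℂ) * g t) (Ioo 0 1) := by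
  obtain ⟨C, hC⟩ := isCompact_Icc.exists_bound_of_continuousOn (s := Icc (0 : ℝ) 1) hg.continuousOn
  refine Integrable.mul_bdd (c := C) (Integrable.ofReal hf) hg.aestronglyMeasurable ?_
  exact (ae_restrict_iff' measurableSet_Ioo).2
    (.of_forall fun t ht => hC t (Ioo_subset_Icc_self ht))

lemma hasDerivAt_expTransform {f : ℝ → ℝ} (hf : IntegrableOn f (Ioo 0 1)) (w : ℂ) :
    HasDerivAt (expTransform f)
      (∫ t in Ioo (0 : ℝ) 1, (f t : ℂ) * (Complex.exp (w * t) * t)) w := by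
  refine (hasDerivAt_integral_of_dominated_loc_of_deriv_le (μ := volume.restrict (Ioo 0 1))
    (F := fun w t => (f t : ℂ) * Complex.exp (w * t))
    (F' := fun w t => (f t : ℂ) * (Complex.exp (w * t) * t))
    (bound := fun t => |f t| * Real.exp (‖w‖ + 1))
    (Metric.ball_mem_nhds w one_pos) ?_ ?_ ?_ ?_ ?_ ?_).2
  · exact .of_forall fun z => (hf.ofReal_mul_continuous_Ioo (by fun_prop)).aestronglyMeasurable
  · exact hf.ofReal_mul_continuous_Ioo (by fun_prop)
  · exact (hf.ofReal_mul_continuous_Ioo (by fun_prop)).aestronglyMeasurable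
  · refine (ae_restrict_iff' measurableSet_Ioo).2 (.of_forall fun t ht z hz => ?_)
    have hz' : ‖z‖ ≤ ‖w‖ + 1 := by
      have := norm_sub_norm_le z w
      rw [Metric.mem_ball, dist_eq_norm] at hz
      linarith
    have ht1 : |t| ≤ 1 := abs_le.2 ⟨by linarith [ht.1], ht.2.le⟩
    have h1 : ‖z * t‖ ≤ ‖w‖ + 1 := by
      rw [norm_mul, Complex.norm_real, Real.norm_eq_abs]
      exact (mul_le_of_le_one_right (norm_nonneg _) ht1).trans hz'
    have h2 : ‖Complex.exp (z * t)‖ ≤ Real.exp (‖w‖ + 1) := by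
      rw [Complex.norm_exp]
      exact Real.exp_le_exp.2 ((Complex.re_le_norm _).trans h1)
    rw [norm_mul, norm_mul, Complex.norm_real, Complex.norm_real, Real.norm_eq_abs,
      Real.norm_eq_abs]
    refine mul_le_mul_of_nonneg_left ?_ (abs_nonneg _)
    exact (mul_le_of_le_one_right (norm_nonneg _) ht1).trans h2
  · exact hf.abs.mul_const _
  · refine .of_forall fun t z _ => ?_
    have := ((hasDerivAt_id z).mul_const (t : ℂ)).cexp
    simpa using this.const_mul (f t : ℂ)

lemma differentiable_expTransform {f : ℝ → ℝ} (hf : IntegrableOn f (Ioo 0 1)) :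
    Differentiable ℂ (expTransform f) :=
  fun w => (hasDerivAt_expTransform hf w).differentiableAt

lemma expTransform_conj (f : ℝ → ℝ) (w : ℂ) :
    expTransform f ((starRingEnd ℂ) w) = (starRingEnd ℂ) (expTransform f w) := by
  rw [expTransform, expTransform, ← integral_conj]
  congr 1
  ext t
  simp [← Complex.exp_conj]

lemma deriv_expTransform_conj {f : ℝ → ℝ} (hf : IntegrableOn f (Ioo 0 1)) (w : ℂ) :
    deriv (expTransform f) ((starRingEnd ℂ) w) = (starRingEnd ℂ) (deriv (expTransform f) w) := by
  have h := (differentiable_expTransform hf w).hasDerivAt.conj_conj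
  have e : (starRingEnd ℂ) ∘ expTransform f ∘ (starRingEnd ℂ) = expTransform f := by
    ext z
    simp [expTransform_conj]
  rw [e] at h
  exact h.deriv

lemma norm_expTransform_neg_le {f : ℝ → ℝ} (hf : IntegrableOn f (Ioo 0 1)) {w : ℂ}
    (hw : 0 ≤ w.re) : ‖expTransform f (-w)‖ ≤ ∫ t in Ioo (0 : ℝ) 1, |f t| := by
  refine (norm_integral_le_integral_norm _).trans ?_
  refine setIntegral_mono_on (hf.ofReal_mul_continuous_Ioo (by fun_prop)).norm hf.abs
    measurableSet_Ioo fun t ht => ?_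
  rw [norm_mul, Complex.norm_real, Real.norm_eq_abs, Complex.norm_exp]
  refine mul_le_of_le_one_right (abs_nonneg _) (Real.exp_le_one_iff.2 ?_)
  simp only [Complex.mul_re, Complex.neg_re, Complex.ofReal_re, Complex.neg_im, Complex.ofReal_im,
    mul_zero, sub_zero]
  nlinarith [ht.1]

/-! ### Lower bounds for the exponential transform in the right half-plane -/

/-- The weighted mean of `1 - Re e^{-w(1-t)}` over `(0, 1)` with weight `2t`. -/
noncomputable def meanDefect (w : ℂ) : ℝ :=
  ∫ t in (0 : ℝ)..1, 2 * t * (1 - (Complex.exp (-w * (1 - t))).re)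

lemma re_exp_neg_mul_le_one {w : ℂ} (hw : 0 ≤ w.re) {t : ℝ} (ht : t ≤ 1) :
    (Complex.exp (-w * (1 - t))).re ≤ 1 := by
  refine (Complex.re_le_norm _).trans ?_
  rw [Complex.norm_exp, Real.exp_le_one_iff]
  have : (-w * (1 - (t : ℂ))).re = -(w.re * (1 - t)) := by simp
  rw [this]
  nlinarith

lemma meanDefect_pos {w : ℂ} (hw : 0 ≤ w.re) (hw0 : w ≠ 0) : 0 < meanDefect w := by
  have hd : 0 < |w.im| + 1 := by positivity
  -- The test point is `t = 1 - r`, with `r` so small that `|Im w| r ≤ 1 < π/2`: the cosine there is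
  -- nonnegative, and less than `1` unless `Im w = 0`, in which case the real exponential decays
  -- strictly.
  set r : ℝ := 1 / (2 * (|w.im| + 1)) with hr
  have hr0 : 0 < r := by positivity
  have hr1 : r ≤ 1 / 2 := by
    rw [hr]
    exact one_div_le_one_div_of_le (by norm_num) (by linarith [abs_nonneg w.im])
  refine intervalIntegral.integral_pos one_pos (Continuous.continuousOn (by fun_prop)) ?_
    ⟨1 - r, ⟨by linarith, by linarith⟩, ?_⟩
  · intro t ht
    have := re_exp_neg_mul_le_one hw ht.2
    have := ht.1
    nlinarith
  · have hlt : (Complex.exp (-w * (1 - ((1 - r : ℝ) : ℂ)))).re < 1 := by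
      have e : -w * (1 - ((1 - r : ℝ) : ℂ)) = -(w * r) := by
        push_cast
        ring
      rw [e, Complex.exp_re]
      simp only [Complex.neg_re, Complex.neg_im, Complex.re_mul_ofReal, Complex.im_mul_ofReal,
        Real.cos_neg]
      have he : Real.exp (-(w.re * r)) ≤ 1 := Real.exp_le_one_iff.2 (by nlinarith)
      by_cases him : w.im = 0
      · have hre : 0 < w.re := lt_of_le_of_ne hw fun h => hw0 (Complex.ext h.symm him)
        have : Real.exp (-(w.re * r)) < 1 := Real.exp_lt_one_iff.2 (by nlinarith)
        simpa [him] using this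
      · have hm : |w.im * r| ≤ 1 := by
          rw [abs_mul, abs_of_pos hr0, hr, mul_one_div, div_le_one (by positivity)]
          linarith [abs_nonneg w.im]
        have hc : Real.cos (w.im * r) < 1 := by
          refine lt_of_le_of_ne (Real.cos_le_one _) fun h => ?_
          have h3 := (Real.cos_eq_one_iff_of_lt_of_lt
            (by linarith [abs_le.1 hm, Real.pi_gt_three])
            (by linarith [abs_le.1 hm, Real.pi_gt_three])).1 h
          exact him ((mul_eq_zero.1 h3).resolve_right hr0.ne')
        have hc0 : 0 ≤ Real.cos (w.im * r) := Real.cos_nonneg_of_mem_Icc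
          ⟨by linarith [abs_le.1 hm, Real.pi_gt_three], by linarith [abs_le.1 hm, Real.pi_gt_three]⟩
        nlinarith
    have : 0 < 2 * (1 - r) := by linarith
    exact mul_pos this (by linarith)

/-- The oscillating part has an explicit antiderivative and is `O(1/|w|)`; for `|w| ≥ 8` its three
terms are at most `1/4 + 1/16 + 1/16 < 1/2`. This uniform bound feeds the growth condition of
Phragmén-Lindelöf. -/
lemma half_le_meanDefect {w : ℂ} (hw : 8 ≤ ‖w‖) (hre : 0 ≤ w.re) : 1 / 2 ≤ meanDefect w := by
  have hw0 : w ≠ 0 := by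
    rintro rfl
    norm_num at hw
  have hpos : 0 < ‖w‖ := by linarith
  have hder : ∀ t : ℝ, HasDerivAt
      (fun t : ℝ => Complex.exp (-w * (1 - t)) * (2 * t / w - 2 / w ^ 2))
      (2 * t * Complex.exp (-w * (1 - t))) t := by
    intro t
    have h1 : HasDerivAt (fun z : ℂ => Complex.exp (-w * (1 - z)) * (2 * z / w - 2 / w ^ 2))
        (2 * t * Complex.exp (-w * (1 - t))) (t : ℂ) := by
      have ha := (((hasDerivAt_id (t : ℂ)).const_sub 1).const_mul (-w)).cexp
      have hb := (((hasDerivAt_id (t : ℂ)).const_mul 2).div_const w).sub_const (2 / w ^ 2)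
      refine (ha.mul hb).congr_deriv ?_
      simp only [id]
      field_simp
      ring
    exact h1.comp_ofReal
  have hint : ∫ t in (0 : ℝ)..1, 2 * (t : ℂ) * Complex.exp (-w * (1 - t)) =
      2 / w - 2 / w ^ 2 + Complex.exp (-w) * (2 / w ^ 2) := by
    rw [intervalIntegral.integral_eq_sub_of_hasDerivAt (fun t _ => hder t)
      (Continuous.intervalIntegrable (by fun_prop) _ _)]
    simp
  have hnorm : ‖∫ t in (0 : ℝ)..1, 2 * (t : ℂ) * Complex.exp (-w * (1 - t))‖ ≤ 1 / 2 := by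
    rw [hint]
    have he : ‖Complex.exp (-w)‖ ≤ 1 := by
      rw [Complex.norm_exp, Real.exp_le_one_iff]
      simpa using hre
    have h2 : ‖2 / w‖ ≤ 1 / 4 := by
      rw [norm_div, Complex.norm_ofNat, div_le_iff₀ hpos]
      linarith
    have h3 : ‖2 / w ^ 2‖ ≤ 1 / 16 := by
      rw [norm_div, Complex.norm_ofNat, norm_pow, div_le_iff₀ (by positivity)]
      nlinarith
    have h4 : ‖Complex.exp (-w) * (2 / w ^ 2)‖ ≤ 1 / 16 := by
      rw [norm_mul]
      exact (mul_le_of_le_one_left (norm_nonneg _) he).trans h3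
    have h5 := norm_add_le (2 / w - 2 / w ^ 2) (Complex.exp (-w) * (2 / w ^ 2))
    have h6 := norm_sub_le (2 / w) (2 / w ^ 2)
    linarith
  have hre' : meanDefect w =
      1 - (∫ t in (0 : ℝ)..1, 2 * (t : ℂ) * Complex.exp (-w * (1 - t))).re := by
    have h1 : (∫ t in (0 : ℝ)..1, 2 * (t : ℂ) * Complex.exp (-w * (1 - t))).re =
        ∫ t in (0 : ℝ)..1, 2 * t * (Complex.exp (-w * (1 - t))).re := by
      have := intervalIntegral.intervalIntegral_re (𝕜 := ℂ) (μ := volume) (a := 0) (b := 1)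
        (f := fun t : ℝ => 2 * (t : ℂ) * Complex.exp (-w * (1 - t)))
        (Continuous.intervalIntegrable (by fun_prop) _ _)
      refine this.symm.trans ?_
      congr 1
      ext t
      simp
    rw [h1, meanDefect]
    have h2 : ∫ t in (0 : ℝ)..1, 2 * t = 1 := by
      rw [intervalIntegral.integral_const_mul, integral_id]
      norm_num
    have h3 := intervalIntegral.integral_sub (μ := volume) (a := 0) (b := 1)
      (f := fun t : ℝ => 2 * t) (g := fun t : ℝ => 2 * t * (Complex.exp (-w * (1 - t))).re)
      (Continuous.intervalIntegrable (by fun_prop) _ _)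
      (Continuous.intervalIntegrable (by fun_prop) _ _)
    rw [h2] at h3
    rw [← h3]
    congr 1
    ext t
    ring
  have := (Complex.abs_re_le_norm _).trans hnorm
  rw [hre']
  linarith [abs_le.1 this]

lemma IsIncreasingWeight.sub_integrableOn {f : ℝ → ℝ} {c : ℝ} (hf : IsIncreasingWeight f c) :
    IntegrableOn (fun t => f t - c * t ^ 2) (Ioo 0 1) :=
  hf.integrableOn.sub (((continuous_const.mul (continuous_pow 2)).integrableOn_Icc
    (a := (0 : ℝ)) (b := 1)).mono_set Ioo_subset_Icc_self)

lemma IsIncreasingWeight.nonneg {f : ℝ → ℝ} {c : ℝ} (hf : IsIncreasingWeight f c) {t : ℝ}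
    (ht : t ∈ Ioo (0 : ℝ) 1) : 0 ≤ f t :=
  (mul_nonneg hf.pos.le (sq_nonneg t)).trans (hf.le t ht)

lemma IsIncreasingWeight.mono {f : ℝ → ℝ} {c : ℝ} (hf : IsIncreasingWeight f c) :
    MonotoneOn f (Ioo 0 1) := by
  intro s hs t ht hst
  have h := hf.monotoneOn hs ht hst
  have h2 : s ^ 2 ≤ t ^ 2 := pow_le_pow_left₀ hs.1.le hst 2
  have := mul_le_mul_of_nonneg_left h2 hf.pos.le
  simp only at h
  linarith

lemma hasDerivAt_one_sub_re_exp (w : ℂ) (t : ℝ) :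
    HasDerivAt (fun t : ℝ => 1 - (Complex.exp (-w * (1 - t))).re)
      (-(w * Complex.exp (-w * (1 - t))).re) t := by
  have h1 : HasDerivAt (fun z : ℂ => Complex.exp (-w * (1 - z)))
      (w * Complex.exp (-w * (1 - t))) (t : ℂ) := by
    refine (((hasDerivAt_id (t : ℂ)).const_sub 1).const_mul (-w)).cexp.congr_deriv ?_
    simp only [id]
    ring
  exact h1.real_of_complex.const_sub 1

/-- The kernel `w e^{-w} e^{wt}` is the `t`-derivative of `e^{-w(1-t)}`, so the tail integrals of
its real part are `1 - Re e^{-w(1-s)} ≥ 0`. The increasing part `f - c t²` therefore contributes a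
nonnegative amount, and `c t²` contributes exactly `c * meanDefect w`. -/
lemma IsIncreasingWeight.mul_meanDefect_le {f : ℝ → ℝ} {c : ℝ} (hf : IsIncreasingWeight f c)
    {w : ℂ} (hw : 0 ≤ w.re) :
    c * meanDefect w ≤ (w * Complex.exp (-w) * expTransform f w).re := by
  set g : ℝ → ℝ := fun t => (w * Complex.exp (-w * (1 - t))).re with hg
  have hgc : Continuous g := by fun_prop
  have hK : (w * Complex.exp (-w) * expTransform f w).re = ∫ t in Ioo (0 : ℝ) 1, f t * g t := by
    have e : w * Complex.exp (-w) * expTransform f w =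
        ∫ t in Ioo (0 : ℝ) 1, (f t : ℂ) * (w * Complex.exp (-w * (1 - t))) := by
      rw [expTransform, ← integral_const_mul]
      congr 1
      ext t
      rw [show -w * (1 - (t : ℂ)) = -w + w * t by ring, Complex.exp_add]
      ring
    rw [e]
    refine (integral_re (𝕜 := ℂ) (hf.integrableOn.ofReal_mul_continuous_Ioo
      (by fun_prop))).symm.trans ?_
    congr 1
    ext t
    exact Complex.re_ofReal_mul _ _
  have hmono := integral_mul_nonneg_of_monotoneOn hf.monotoneOn
    (fun t ht => sub_nonneg.2 (hf.le t ht)) hf.sub_integrableOn hgc (fun s hs => by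
      have := intervalIntegral.integral_eq_sub_of_hasDerivAt
        (fun t _ => hasDerivAt_one_sub_re_exp w t) (a := s) (b := 1)
        (Continuous.intervalIntegrable (by fun_prop) _ _)
      rw [intervalIntegral.integral_neg] at this
      have h1 := re_exp_neg_mul_le_one hw hs.2
      simp only [Complex.ofReal_one, sub_self, mul_zero, Complex.exp_zero, Complex.one_re] at this
      linarith)
  -- Integration by parts; the boundary terms vanish, at `1` because `1 - Re e⁰ = 0` and at `0`
  -- because of `t²`.
  have hsq : ∫ t in Ioo (0 : ℝ) 1, t ^ 2 * g t = meanDefect w := by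
    rw [← integral_Ioc_eq_integral_Ioo, ← intervalIntegral.integral_of_le zero_le_one]
    have h := intervalIntegral.integral_mul_deriv_eq_deriv_mul (a := 0) (b := 1)
      (u := fun t : ℝ => t ^ 2) (u' := fun t => 2 * t)
      (fun t _ => by simpa using hasDerivAt_pow 2 t)
      (fun t _ => hasDerivAt_one_sub_re_exp w t)
      (Continuous.intervalIntegrable (by fun_prop) _ _)
      (Continuous.intervalIntegrable (by fun_prop) _ _)
    simp only [Complex.ofReal_one, sub_self, mul_zero, Complex.exp_zero, Complex.one_re, mul_neg,
      intervalIntegral.integral_neg] at h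
    have : ∫ t in (0 : ℝ)..1, t ^ 2 * g t =
      ∫ t in (0 : ℝ)..1, t ^ 2 * (w * Complex.exp (-w * (1 - t))).re := rfl
    rw [this, meanDefect]
    simp only [ne_eq, OfNat.ofNat_ne_zero, not_false_eq_true, zero_pow, zero_mul, sub_zero] at h
    linarith
  have hsplit : ∫ t in Ioo (0 : ℝ) 1, (f t - c * t ^ 2) * g t =
      (∫ t in Ioo (0 : ℝ) 1, f t * g t) - c * ∫ t in Ioo (0 : ℝ) 1, t ^ 2 * g t := by
    rw [← integral_const_mul, ← integral_sub (hf.integrableOn.mul_continuous_Ioo hgc)]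
    · congr 1
      ext t
      ring
    · exact (Continuous.integrableOn_Icc (a := (0 : ℝ)) (b := 1) (by fun_prop)).mono_set
        Ioo_subset_Icc_self
  rw [hK]
  rw [hsplit, hsq] at hmono
  linarith

lemma expTransform_ofReal (f : ℝ → ℝ) (x : ℝ) :
    expTransform f x = ((∫ t in Ioo (0 : ℝ) 1, f t * Real.exp (x * t) : ℝ) : ℂ) := by
  rw [expTransform, ← integral_complex_ofReal]
  congr 1
  ext t
  push_cast
  rfl

lemma IsIncreasingWeight.integral_pos {f : ℝ → ℝ} {c : ℝ} (hf : IsIncreasingWeight f c) :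
    0 < ∫ t in Ioo (0 : ℝ) 1, f t := by
  have h1 : ∫ t in Ioo (0 : ℝ) 1, c * t ^ 2 = c * (1 / 3) := by
    rw [← integral_Ioc_eq_integral_Ioo, ← intervalIntegral.integral_of_le zero_le_one,
      intervalIntegral.integral_const_mul, integral_pow]
    norm_num
  have h2 : ∫ t in Ioo (0 : ℝ) 1, c * t ^ 2 ≤ ∫ t in Ioo (0 : ℝ) 1, f t :=
    setIntegral_mono_on ((Continuous.integrableOn_Icc (a := (0 : ℝ)) (b := 1)
      (by fun_prop)).mono_set Ioo_subset_Icc_self) hf.integrableOn measurableSet_Ioo hf.le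
  have := hf.pos
  linarith

lemma IsIncreasingWeight.expTransform_zero_ne {f : ℝ → ℝ} {c : ℝ} (hf : IsIncreasingWeight f c) :
    expTransform f 0 ≠ 0 := by
  have h := expTransform_ofReal f 0
  simp only [Complex.ofReal_zero, zero_mul, Real.exp_zero, mul_one] at h
  rw [h]
  exact_mod_cast hf.integral_pos.ne'

lemma IsIncreasingWeight.expTransform_ne_zero {f : ℝ → ℝ} {c : ℝ} (hf : IsIncreasingWeight f c)
    {w : ℂ} (hw : 0 ≤ w.re) : expTransform f w ≠ 0 := by
  by_cases hw0 : w = 0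
  · rw [hw0]
    exact hf.expTransform_zero_ne
  · intro h
    have := hf.mul_meanDefect_le hw
    rw [h, mul_zero, Complex.zero_re] at this
    exact absurd this (not_le.2 (mul_pos hf.pos (meanDefect_pos hw hw0)))

/-- Since `L(-x) e^x = ∫ f(t) e^{x(1-t)} dt`, this compares `f` with its reflection `t ↦ 1 - t`. It
gives the boundedness on the positive real axis that Phragmén-Lindelöf needs at order one. -/
lemma IsIncreasingWeight.norm_expTransform_neg_le_of_real {f : ℝ → ℝ} {c : ℝ}
    (hf : IsIncreasingWeight f c) {x : ℝ} (hx : 0 < x) :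
    ‖expTransform f (-x)‖ * Real.exp x ≤ ‖expTransform f x‖ := by
  have hi := hf.integrableOn
  have key := integral_mul_nonneg_of_monotoneOn hf.mono (fun t ht => hf.nonneg ht) hi
    (g := fun t => Real.exp (x * t) - Real.exp (x * (1 - t))) (by fun_prop) (fun s hs => by
      have hd : ∀ t : ℝ, HasDerivAt (fun t => (Real.exp (x * t) + Real.exp (x * (1 - t))) / x)
          (Real.exp (x * t) - Real.exp (x * (1 - t))) t := by
        intro t
        have h1 := ((hasDerivAt_id t).const_mul x).exp
        have h2 := (((hasDerivAt_id t).const_sub 1).const_mul x).exp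
        refine ((h1.add h2).div_const x).congr_deriv ?_
        simp only [id]
        field_simp
        ring
      rw [intervalIntegral.integral_eq_sub_of_hasDerivAt (fun t _ => hd t)
        (Continuous.intervalIntegrable (by fun_prop) _ _), ← sub_div]
      refine div_nonneg ?_ hx.le
      -- With `a = e^{xs}` and `b = e^{x(1-s)}`, the claim becomes `ab + 1 - a - b = (a - 1)(b - 1)
      -- ≥ 0`.
      have e : Real.exp (x * 1) = Real.exp (x * s) * Real.exp (x * (1 - s)) := by
        rw [← Real.exp_add]
        ring_nf
      have h1 : 1 ≤ Real.exp (x * s) := Real.one_le_exp (mul_nonneg hx.le hs.1)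
      have h2 : 1 ≤ Real.exp (x * (1 - s)) := Real.one_le_exp (mul_nonneg hx.le (by linarith [hs.2]))
      rw [e, sub_self, mul_zero, Real.exp_zero]
      nlinarith)
  have hsplit : ∫ t in Ioo (0 : ℝ) 1, f t * (Real.exp (x * t) - Real.exp (x * (1 - t))) =
      (∫ t in Ioo (0 : ℝ) 1, f t * Real.exp (x * t)) -
        (∫ t in Ioo (0 : ℝ) 1, f t * Real.exp (-x * t)) * Real.exp x := by
    rw [← integral_mul_const, ← integral_sub (hi.mul_continuous_Ioo (by fun_prop))
      ((hi.mul_continuous_Ioo (by fun_prop)).mul_const _)]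
    congr 1
    ext t
    rw [show x * (1 - t) = -x * t + x by ring, Real.exp_add]
    ring
  have hpos : ∀ y : ℝ, 0 ≤ ∫ t in Ioo (0 : ℝ) 1, f t * Real.exp (y * t) := fun y =>
    setIntegral_nonneg measurableSet_Ioo fun t ht =>
      mul_nonneg (hf.nonneg ht) (Real.exp_nonneg _)
  rw [← Complex.ofReal_neg, expTransform_ofReal, expTransform_ofReal, Complex.norm_real,
    Complex.norm_real, Real.norm_of_nonneg (hpos _), Real.norm_of_nonneg (hpos _)]
  rw [hsplit] at key
  linarith

lemma IsIncreasingWeight.norm_le_of_large {f : ℝ → ℝ} {c : ℝ} (hf : IsIncreasingWeight f c)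
    {w : ℂ} (hw : 0 ≤ w.re) (h8 : 8 ≤ ‖w‖) :
    c / 2 * Real.exp w.re ≤ ‖w‖ * ‖expTransform f w‖ := by
  have h1 := (hf.mul_meanDefect_le hw).trans (Complex.re_le_norm _)
  have h2 := mul_le_mul_of_nonneg_left (half_le_meanDefect h8 hw) hf.pos.le
  rw [norm_mul, norm_mul, Complex.norm_exp, Complex.neg_re] at h1
  have h3 : Real.exp (-w.re) * Real.exp w.re = 1 := by rw [← Real.exp_add]; simp
  have h4 : c / 2 ≤ ‖w‖ * Real.exp (-w.re) * ‖expTransform f w‖ := by linarith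
  calc c / 2 * Real.exp w.re ≤ ‖w‖ * Real.exp (-w.re) * ‖expTransform f w‖ * Real.exp w.re :=
        mul_le_mul_of_nonneg_right h4 (Real.exp_nonneg _)
    _ = ‖w‖ * ‖expTransform f w‖ * (Real.exp (-w.re) * Real.exp w.re) := by ring
    _ = _ := by rw [h3, mul_one]

/-! ### Phragmén-Lindelöf comparison of `L(w)` and `L(-w)` -/

/-- The transform of an increasing weight is larger on the right half-plane than on its reflection,
with the exponential gain that Phragmén-Lindelöf allows. -/
theorem IsIncreasingWeight.norm_expTransform_neg_mul_exp_le {f : ℝ → ℝ} {c : ℝ}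
    (hf : IsIncreasingWeight f c) {w : ℂ} (hw : 0 ≤ w.re) :
    ‖expTransform f (-w)‖ * Real.exp w.re ≤ ‖expTransform f w‖ := by
  -- On the imaginary axis `-w` is the conjugate of `w` and `|e^w| = 1`, so `B` has modulus `1`
  -- there; the aim is to carry the bound `1` into the half-plane.
  set B : ℂ → ℂ := fun w => expTransform f (-w) * Complex.exp w / expTransform f w with hB
  have hd := differentiable_expTransform hf.integrableOn
  have hnorm : ∀ z : ℂ, ‖B z‖ = ‖expTransform f (-z)‖ * Real.exp z.re / ‖expTransform f z‖ := by
    intro z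
    simp only [hB, norm_div, norm_mul, Complex.norm_exp]
  suffices h : ‖B w‖ ≤ 1 by
    rw [hnorm, div_le_one (norm_pos_iff.2 (hf.expTransform_ne_zero hw))] at h
    exact h
  have hc := hf.pos
  refine PhragmenLindelof.right_half_plane_of_bounded_on_real ?_ ⟨1, by norm_num, 1, ?_⟩ ?_ ?_ hw
  · refine DifferentiableOn.diffContOnCl fun z hz => ?_
    have hz' : 0 ≤ z.re := by
      rw [Complex.closure_setOfPred_lt_re] at hz
      exact hz
    exact ((((hd (-z)).comp z differentiableAt_id.neg).mul
      Complex.differentiableAt_exp).div (hd z)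
      (hf.expTransform_ne_zero hz')).differentiableWithinAt
  -- The numerator is at most `A e^{Re z}` and the denominator at least `c e^{Re z} / (2|z|)`, so
  -- `B` in fact grows at most linearly.
  · set A := ∫ t in Ioo (0 : ℝ) 1, |f t| with hA
    have hA0 : 0 ≤ A := integral_nonneg fun t => abs_nonneg _
    refine Asymptotics.IsBigO.of_bound (2 * A / c) ?_
    have hlarge : ∀ᶠ z : ℂ in Bornology.cobounded ℂ, 8 ≤ ‖z‖ :=
      tendsto_norm_cobounded_atTop.eventually_ge_atTop 8
    filter_upwards [hlarge.filter_mono inf_le_left,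
      Filter.Eventually.filter_mono inf_le_right (Filter.mem_principal_self _)] with z hz hre
    have hre' : 0 ≤ z.re := le_of_lt hre
    have hz0 : 0 < ‖expTransform f z‖ := norm_pos_iff.2 (hf.expTransform_ne_zero hre')
    have h1 := hf.norm_le_of_large hre' hz
    have h2 := norm_expTransform_neg_le hf.integrableOn hre'
    have h3 : ‖z‖ ≤ Real.exp ‖z‖ := by linarith [Real.add_one_le_exp ‖z‖]
    rw [hnorm, Real.rpow_one, one_mul, Real.norm_of_nonneg (Real.exp_nonneg _), div_le_iff₀ hz0]
    calc ‖expTransform f (-z)‖ * Real.exp z.re ≤ A * Real.exp z.re :=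
          mul_le_mul_of_nonneg_right h2 (Real.exp_nonneg _)
      _ = 2 * A / c * (c / 2 * Real.exp z.re) := by field_simp
      _ ≤ 2 * A / c * (‖z‖ * ‖expTransform f z‖) :=
          mul_le_mul_of_nonneg_left h1 (by positivity)
      _ ≤ 2 * A / c * (Real.exp ‖z‖ * ‖expTransform f z‖) := by gcongr
      _ = _ := by ring
  · refine Filter.isBoundedUnder_of_eventually_le (a := 1) ?_
    filter_upwards [Filter.eventually_gt_atTop (0 : ℝ)] with x hx
    rw [hnorm, Complex.ofReal_re, div_le_one (norm_pos_iff.2 (hf.expTransform_ne_zero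
      (by simpa using hx.le)))]
    exact hf.norm_expTransform_neg_le_of_real hx
  · intro x
    have e : -((x : ℂ) * Complex.I) = (starRingEnd ℂ) ((x : ℂ) * Complex.I) := by simp
    rw [hnorm, e, expTransform_conj, Complex.norm_conj]
    simp only [Complex.mul_re, Complex.ofReal_re, Complex.I_re, mul_zero, Complex.ofReal_im,
      Complex.I_im, mul_one, sub_self, Real.exp_zero]
    exact div_self_le_one _

/-! ### The cosine transform: real and simple zeros -/

/-- The transform `z ↦ ∫₀¹ f(t) cos(zt - θ) dt`. -/
noncomputable def cosTransform (f : ℝ → ℝ) (θ : ℝ) (z : ℂ) : ℂ :=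
  ∫ t in Ioo (0 : ℝ) 1, (f t : ℂ) * Complex.cos (z * t - θ)

lemma cosTransform_eq {f : ℝ → ℝ} (hf : IntegrableOn f (Ioo 0 1)) (θ : ℝ) (z : ℂ) :
    cosTransform f θ z = (Complex.exp (-(θ * Complex.I)) * expTransform f (z * Complex.I) +
      Complex.exp (θ * Complex.I) * expTransform f (-(z * Complex.I))) / 2 := by
  rw [cosTransform, expTransform, expTransform, ← integral_const_mul, ← integral_const_mul,
    ← integral_add ((hf.ofReal_mul_continuous_Ioo (by fun_prop)).const_mul _)
      ((hf.ofReal_mul_continuous_Ioo (by fun_prop)).const_mul _), ← integral_div]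
  congr 1
  ext t
  rw [Complex.cos,
    show (z * t - θ) * Complex.I = -(θ * Complex.I) + z * Complex.I * t by ring,
    show -(z * t - θ) * Complex.I = θ * Complex.I + -(z * Complex.I) * t by ring,
    Complex.exp_add, Complex.exp_add]
  ring

lemma differentiable_cosTransform {f : ℝ → ℝ} (hf : IntegrableOn f (Ioo 0 1)) (θ : ℝ) :
    Differentiable ℂ (cosTransform f θ) := by
  have hd := differentiable_expTransform hf
  rw [funext (cosTransform_eq hf θ)]
  have h1 : Differentiable ℂ fun z => expTransform f (z * Complex.I) :=
    hd.comp (differentiable_id.mul_const _)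
  have h2 : Differentiable ℂ fun z => expTransform f (-(z * Complex.I)) :=
    hd.comp (differentiable_id.mul_const _).neg
  fun_prop

lemma cosTransform_ofReal_im (f : ℝ → ℝ) (θ x : ℝ) : (cosTransform f θ x).im = 0 := by
  rw [cosTransform]
  have : ∀ t : ℝ, (f t : ℂ) * Complex.cos (x * t - θ) = ((f t * Real.cos (x * t - θ) : ℝ) : ℂ) :=
    fun t => by push_cast; rfl
  simp_rw [this]
  rw [integral_complex_ofReal, Complex.ofReal_im]

lemma cosTransform_ofReal (f : ℝ → ℝ) (θ x : ℝ) :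
    cosTransform f θ x = ((∫ t in Ioo (0 : ℝ) 1, f t * Real.cos (x * t - θ) : ℝ) : ℂ) := by
  rw [cosTransform, ← integral_complex_ofReal]
  congr 1
  ext t
  push_cast
  rfl

lemma conj_ofReal_mul_I (x : ℝ) : (starRingEnd ℂ) (x * Complex.I) = -(x * Complex.I) := by simp

/-- For real `x` the two exponential terms are conjugate, so `F(x) = Re W` with `W = e^{-iθ} L(ix)`;
likewise `F'(x) = -Im(e^{-iθ} L'(ix))` in `deriv_cosTransform_ofReal`. -/
lemma cosTransform_ofReal_re {f : ℝ → ℝ} (hf : IntegrableOn f (Ioo 0 1)) (θ x : ℝ) :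
    (cosTransform f θ x).re =
      (Complex.exp (-(θ * Complex.I)) * expTransform f (x * Complex.I)).re := by
  have h : cosTransform f θ x =
      (Complex.exp (-(θ * Complex.I)) * expTransform f (x * Complex.I) +
      (starRingEnd ℂ) (Complex.exp (-(θ * Complex.I)) * expTransform f (x * Complex.I))) / 2 := by
    rw [cosTransform_eq hf, map_mul, ← Complex.exp_conj, map_neg, conj_ofReal_mul_I,
      ← expTransform_conj, conj_ofReal_mul_I, neg_neg]
  rw [h, Complex.add_conj]
  norm_num

lemma deriv_cosTransform_ofReal {f : ℝ → ℝ} (hf : IntegrableOn f (Ioo 0 1)) (θ x : ℝ) :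
    deriv (cosTransform f θ) x =
      ((-(Complex.exp (-(θ * Complex.I)) * deriv (expTransform f) (x * Complex.I)).im : ℝ) : ℂ) := by
  have hd := differentiable_expTransform hf
  set P := Complex.exp (-(θ * Complex.I)) * deriv (expTransform f) (x * Complex.I) with hP
  have h1 : HasDerivAt (fun z => expTransform f (z * Complex.I))
      (deriv (expTransform f) (x * Complex.I) * Complex.I) (x : ℂ) := by
    have := (hd (x * Complex.I)).hasDerivAt.comp (x : ℂ)
      ((hasDerivAt_id (x : ℂ)).mul_const Complex.I)
    simpa [Function.comp_def] using this
  have h2 : HasDerivAt (fun z => expTransform f (-(z * Complex.I)))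
      (deriv (expTransform f) (-(x * Complex.I)) * -Complex.I) (x : ℂ) := by
    have := (hd (-(x * Complex.I))).hasDerivAt.comp (x : ℂ)
      ((hasDerivAt_id (x : ℂ)).mul_const Complex.I).neg
    simpa [Function.comp_def] using this
  have h3 := ((h1.const_mul (Complex.exp (-(θ * Complex.I)))).add
    (h2.const_mul (Complex.exp (θ * Complex.I)))).div_const 2
  have hc : Complex.exp (θ * Complex.I) * deriv (expTransform f) (-(x * Complex.I)) =
      (starRingEnd ℂ) P := by
    rw [hP, map_mul, ← Complex.exp_conj, map_neg, conj_ofReal_mul_I,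
      ← deriv_expTransform_conj hf, conj_ofReal_mul_I, neg_neg]
  rw [funext (cosTransform_eq hf θ)]
  refine h3.deriv.trans ?_
  have e : (Complex.exp (-(θ * Complex.I)) * (deriv (expTransform f) (x * Complex.I) * Complex.I) +
      Complex.exp (θ * Complex.I) * (deriv (expTransform f) (-(x * Complex.I)) * -Complex.I)) / 2 =
      (P - (starRingEnd ℂ) P) * Complex.I / 2 := by
    rw [← hc, hP]
    ring
  rw [e, Complex.sub_conj]
  push_cast
  linear_combination (P.im : ℂ) * Complex.I_mul_I

lemma nonneg_of_hasDerivAt_of_nonneg_right {q : ℝ → ℝ} {q' : ℝ} (h : HasDerivAt q q' 0)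
    (h0 : q 0 = 0) (hq : ∀ y, 0 < y → 0 ≤ q y) : 0 ≤ q' := by
  refine ge_of_tendsto h.tendsto_slope_zero_right ?_
  filter_upwards [self_mem_nhdsWithin] with t ht
  rw [zero_add, h0, sub_zero, smul_eq_mul]
  exact mul_nonneg (inv_nonneg.2 (le_of_lt ht)) (hq t ht)

/-- The function `|L(y + ix)|² - |L(-y + ix)|² e^{2y}` vanishes at `y = 0` and is nonnegative for `y
> 0`, so its derivative at `0`, which is `4D - 2|L(ix)|²`, is nonnegative. Since `D / |L(ix)|²` is
the `x`-derivative of `arg L(ix)`, this is a lower bound `1/2` for the angular speed. -/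
lemma IsIncreasingWeight.normSq_le_re_conj_mul_deriv {f : ℝ → ℝ} {c : ℝ}
    (hf : IsIncreasingWeight f c) (x : ℝ) :
    ‖expTransform f (x * Complex.I)‖ ^ 2 / 2 ≤
      ((starRingEnd ℂ) (expTransform f (x * Complex.I)) *
        deriv (expTransform f) (x * Complex.I)).re := by
  have hd := differentiable_expTransform hf.integrableOn
  set n : ℝ → ℝ := fun y => ‖expTransform f (y + x * Complex.I)‖ ^ 2 with hn
  set D := ((starRingEnd ℂ) (expTransform f (x * Complex.I)) *
    deriv (expTransform f) (x * Complex.I)).re with hD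
  have h1 : HasDerivAt (fun y : ℝ => expTransform f (y + x * Complex.I))
      (deriv (expTransform f) (x * Complex.I)) 0 := by
    have h : HasDerivAt (fun y : ℂ => expTransform f (y + x * Complex.I))
        (deriv (expTransform f) (((0 : ℝ) : ℂ) + x * Complex.I)) ((0 : ℝ) : ℂ) :=
      (hd _).hasDerivAt.comp_add_const _ _
    rw [Complex.ofReal_zero, zero_add] at h
    exact h.comp_ofReal
  have h2 : HasDerivAt n (2 * D) 0 := by
    have := h1.norm_sq
    rw [Complex.inner] at this
    simp only [Complex.ofReal_zero, zero_add] at this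
    rw [hD, mul_comm ((starRingEnd ℂ) _)]
    convert this using 1
  have h3 : HasDerivAt (fun y => n (-y)) (-(2 * D)) 0 := by
    have h := HasDerivAt.scomp (0 : ℝ) (by simpa using h2) (hasDerivAt_neg (0 : ℝ))
    simpa [Function.comp_def] using h
  have h4 : HasDerivAt (fun y : ℝ => Real.exp (2 * y)) 2 0 := by
    simpa using ((hasDerivAt_id (0 : ℝ)).const_mul 2).exp
  have h5 := h2.sub (h3.mul h4)
  have h6 := nonneg_of_hasDerivAt_of_nonneg_right h5 (by simp) (fun y hy => by
    have h := hf.norm_expTransform_neg_mul_exp_le (w := y + x * Complex.I) (by simpa using hy.le)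
    have e : -((y : ℂ) + x * Complex.I) =
        (starRingEnd ℂ) (((-y : ℝ) : ℂ) + x * Complex.I) := by
      rw [map_add, conj_ofReal_mul_I, Complex.conj_ofReal]
      push_cast
      ring
    rw [e, expTransform_conj, Complex.norm_conj] at h
    have hre : ((y : ℂ) + x * Complex.I).re = y := by simp
    rw [hre] at h
    have h' := pow_le_pow_left₀ (by positivity) h 2
    rw [mul_pow, ← Real.exp_nat_mul] at h'
    simp only [hn, Pi.sub_apply, Pi.mul_apply]
    push_cast at h' ⊢
    linarith)
  simp only [neg_zero, mul_zero, Real.exp_zero] at h6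
  have h7 : n 0 = ‖expTransform f (x * Complex.I)‖ ^ 2 := by simp [hn]
  rw [h7] at h6
  linarith

/-- Zeros of the cosine transform of an increasing weight are real. -/
lemma IsIncreasingWeight.im_eq_zero {f : ℝ → ℝ} {c : ℝ} (hf : IsIncreasingWeight f c) (θ : ℝ)
    {z : ℂ} (hz : cosTransform f θ z = 0) : z.im = 0 := by
  have key : ∀ w : ℂ, 0 < w.re → ‖expTransform f (-w)‖ < ‖expTransform f w‖ := by
    intro w hw
    have h1 := hf.norm_expTransform_neg_mul_exp_le hw.le
    have h2 := norm_pos_iff.2 (hf.expTransform_ne_zero hw.le)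
    have h3 := Real.one_lt_exp_iff.2 hw
    nlinarith [norm_nonneg (expTransform f (-w))]
  rw [cosTransform_eq hf.integrableOn, div_eq_zero_iff, or_iff_left two_ne_zero] at hz
  have hnorm := congrArg norm (eq_neg_of_add_eq_zero_left hz)
  have hn1 : ‖Complex.exp (-(θ * Complex.I))‖ = 1 := by
    rw [← neg_mul, ← Complex.ofReal_neg, Complex.norm_exp_ofReal_mul_I]
  rw [norm_neg, norm_mul, norm_mul, hn1, Complex.norm_exp_ofReal_mul_I, one_mul, one_mul] at hnorm
  rcases lt_trichotomy z.im 0 with h | h | h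
  · exact absurd hnorm (key (z * Complex.I) (by simpa using h)).ne'
  · exact h
  · have := key (-(z * Complex.I)) (by simpa using h)
    rw [neg_neg] at this
    exact absurd hnorm this.ne

/-- This is positivity of `Re(w e^{-w} L(w))` at `w = ix`, where the expression equals `ix
e^{-i(x-θ)} W` with `W = e^{-iθ} L(ix)`. -/
lemma IsIncreasingWeight.phase {f : ℝ → ℝ} {c : ℝ} (hf : IsIncreasingWeight f c) (θ : ℝ)
    {x : ℝ} (hx : x ≠ 0) :
    0 < x * (Real.sin (x - θ) *
        (Complex.exp (-(θ * Complex.I)) * expTransform f (x * Complex.I)).re -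
      Real.cos (x - θ) *
        (Complex.exp (-(θ * Complex.I)) * expTransform f (x * Complex.I)).im) := by
  have h0 : (x : ℂ) * Complex.I ≠ 0 := by simp [hx]
  have hre : 0 ≤ ((x : ℂ) * Complex.I).re := by simp
  have h := (mul_pos hf.pos (meanDefect_pos hre h0)).trans_le (hf.mul_meanDefect_le hre)
  set W := Complex.exp (-(θ * Complex.I)) * expTransform f (x * Complex.I) with hW
  have e : (x : ℂ) * Complex.I * Complex.exp (-(x * Complex.I)) *
      expTransform f (x * Complex.I) =
      x * Complex.I * (Complex.cos ((x - θ : ℝ) : ℂ) - Complex.sin ((x - θ : ℝ) : ℂ) * Complex.I) *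
        W := by
    have : Complex.cos ((x - θ : ℝ) : ℂ) - Complex.sin ((x - θ : ℝ) : ℂ) * Complex.I =
        Complex.exp (-(x * Complex.I)) * Complex.exp (θ * Complex.I) := by
      rw [← Complex.exp_add, show -(x * Complex.I) + θ * Complex.I =
        ((-(x - θ) : ℝ) : ℂ) * Complex.I by push_cast; ring, Complex.exp_mul_I]
      push_cast
      rw [Complex.cos_neg, Complex.sin_neg]
      ring
    have h1 : Complex.exp (θ * Complex.I) * Complex.exp (-(θ * Complex.I)) = 1 := by
      rw [← Complex.exp_add]
      simp
    rw [this, hW]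
    linear_combination (-(x : ℂ) * Complex.I * Complex.exp (-(x * Complex.I)) *
      expTransform f (x * Complex.I)) * h1
  rw [e, ← Complex.ofReal_cos, ← Complex.ofReal_sin] at h
  generalize Real.cos (x - θ) = C at h ⊢
  generalize Real.sin (x - θ) = S at h ⊢
  simp only [Complex.mul_re, Complex.mul_im, Complex.sub_re, Complex.sub_im, Complex.ofReal_re,
    Complex.ofReal_im, Complex.I_re, Complex.I_im] at h
  linarith

/-- At a real zero `Re W = 0`, so the product of imaginary parts is all of `Re(conj(L) L')`, which
is at least `|L|²/2 > 0`. The origin is not excluded, so simplicity also covers a zero at `0`. -/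
lemma IsIncreasingWeight.im_mul_im_pos {f : ℝ → ℝ} {c : ℝ} (hf : IsIncreasingWeight f c) (θ : ℝ)
    {x : ℝ} (hx : cosTransform f θ x = 0) :
    0 < (Complex.exp (-(θ * Complex.I)) * expTransform f (x * Complex.I)).im *
      (Complex.exp (-(θ * Complex.I)) * deriv (expTransform f) (x * Complex.I)).im := by
  have h1 := hf.normSq_le_re_conj_mul_deriv x
  have h2 : 0 < ‖expTransform f (x * Complex.I)‖ :=
    norm_pos_iff.2 (hf.expTransform_ne_zero (by simp))
  have h3 := cosTransform_ofReal_re hf.integrableOn θ x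
  rw [hx, Complex.zero_re] at h3
  set L := expTransform f (x * Complex.I)
  set D := deriv (expTransform f) (x * Complex.I)
  set E := Complex.exp (-(θ * Complex.I)) with hE
  have hE1 : (starRingEnd ℂ) E * E = 1 := by
    rw [hE, ← Complex.exp_conj, map_neg, conj_ofReal_mul_I, ← Complex.exp_add]
    simp
  have h4 : (starRingEnd ℂ) (E * L) * (E * D) = (starRingEnd ℂ) L * D := by
    rw [map_mul]
    linear_combination ((starRingEnd ℂ) L * D) * hE1
  rw [← h4, Complex.mul_re, Complex.conj_re, Complex.conj_im, ← h3] at h1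
  have : 0 < ‖L‖ ^ 2 / 2 := by positivity
  linarith

lemma IsIncreasingWeight.deriv_ne_zero {f : ℝ → ℝ} {c : ℝ} (hf : IsIncreasingWeight f c) (θ : ℝ)
    {x : ℝ} (hx : cosTransform f θ x = 0) : deriv (cosTransform f θ) x ≠ 0 := by
  rw [deriv_cosTransform_ofReal hf.integrableOn, Ne, Complex.ofReal_eq_zero, neg_eq_zero]
  intro h
  have := hf.im_mul_im_pos θ hx
  rw [h, mul_zero] at this
  exact lt_irrefl _ this

/-- At a zero, `phase` reduces to `-x cos(x - θ) Im W > 0`; multiplying by the positive product of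
imaginary parts leaves the claim times `(Im W)²`. -/
lemma IsIncreasingWeight.mul_cos_mul_deriv_pos {f : ℝ → ℝ} {c : ℝ} (hf : IsIncreasingWeight f c)
    (θ : ℝ) {x : ℝ} (hx0 : x ≠ 0) (hx : cosTransform f θ x = 0) :
    0 < x * Real.cos (x - θ) * (deriv (cosTransform f θ) x).re := by
  have h1 := hf.im_mul_im_pos θ hx
  have h2 := hf.phase θ hx0
  have h3 := cosTransform_ofReal_re hf.integrableOn θ x
  rw [hx, Complex.zero_re] at h3
  rw [← h3] at h2
  rw [deriv_cosTransform_ofReal hf.integrableOn, Complex.ofReal_re]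
  set a := (Complex.exp (-(θ * Complex.I)) * expTransform f (x * Complex.I)).im
  set b := (Complex.exp (-(θ * Complex.I)) * deriv (expTransform f) (x * Complex.I)).im
  have ha : 0 < a ^ 2 := by
    refine lt_of_le_of_ne (sq_nonneg a) fun h => ?_
    rw [pow_eq_zero_iff two_ne_zero |>.1 h.symm, zero_mul] at h1
    exact lt_irrefl _ h1
  refine pos_of_mul_pos_left (b := a ^ 2) ?_ ha.le
  have := mul_pos h2 h1
  linarith

/-- Only the sine term of `phase` survives. It fixes the sign of `F` at the end points of the
intervals and excludes nonzero zeros there. -/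
lemma IsIncreasingWeight.mul_sin_mul_pos {f : ℝ → ℝ} {c : ℝ} (hf : IsIncreasingWeight f c)
    (θ : ℝ) {x : ℝ} (hx0 : x ≠ 0) (hx : Real.cos (x - θ) = 0) :
    0 < x * Real.sin (x - θ) * (cosTransform f θ x).re := by
  have h2 := hf.phase θ hx0
  rw [← cosTransform_ofReal_re hf.integrableOn θ x, hx] at h2
  linarith

/-! ### Counting zeros in the intervals -/

/-- A function that crosses zero only upwards has exactly one zero between a negative and a
positive value. -/
lemma existsUnique_zero_of_deriv_pos {ψ ψ' : ℝ → ℝ} {a b : ℝ} (hab : a < b)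
    (hd : ∀ x, HasDerivAt ψ (ψ' x) x) (ha : ψ a < 0) (hb : 0 < ψ b)
    (hz : ∀ x ∈ Ioo a b, ψ x = 0 → 0 < ψ' x) : ∃! x, x ∈ Ioo a b ∧ ψ x = 0 := by
  have hc : Continuous ψ := continuous_iff_continuousAt.2 fun x => (hd x).continuousAt
  obtain ⟨x, hx, hx0⟩ := intermediate_value_Ioo hab.le hc.continuousOn ⟨ha, hb⟩
  have key : ∀ p q, p ∈ Ioo a b → q ∈ Ioo a b → ψ p = 0 → ψ q = 0 → ¬ p < q := by
    intro p q hp hq hp0 hq0 hpq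
    -- After an upward crossing at `p`, `ψ` cannot drop below the barrier `0`, since each return to
    -- `0` is again upward. Then the left difference quotients at `q` are at most `0`, contradicting
    -- `ψ' q > 0`.
    have hnn : ∀ y ∈ Icc p q, 0 ≤ ψ y := by
      intro y hy
      have := image_le_of_deriv_right_lt_deriv_boundary (f := fun y => -ψ y) (f' := fun y => -ψ' y)
        (a := p) (b := q) hc.neg.continuousOn (fun y _ => (hd y).neg.hasDerivWithinAt)
        (B := fun _ => 0) (B' := fun _ => 0) (by simp [hp0]) (fun y => hasDerivAt_const y 0)
        (fun y hy h => by
          have := hz y ⟨hp.1.trans_le hy.1, hy.2.trans hq.2⟩ (neg_eq_zero.1 h)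
          linarith) hy
      simpa using this
    have hq' := hz q hq hq0
    have hle : ψ' q ≤ 0 := by
      refine le_of_tendsto (hd q).tendsto_slope_zero_left ?_
      have : Ioo (p - q) 0 ∈ nhdsWithin (0 : ℝ) (Iio 0) := Ioo_mem_nhdsLT (by linarith)
      filter_upwards [this] with t ht
      rw [hq0, sub_zero, smul_eq_mul]
      exact mul_nonpos_of_nonpos_of_nonneg (inv_nonpos.2 ht.2.le)
        (hnn _ ⟨by linarith [ht.1], by linarith [ht.2]⟩)
    linarith
  refine ⟨x, ⟨hx, hx0⟩, fun y hy => ?_⟩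
  rcases lt_trichotomy y x with h | h | h
  · exact absurd h (key y x hy.1 hx hy.2 hx0)
  · exact h
  · exact absurd h (key x y hx hy.1 hx0 hy.2)

lemma sign_mul_cos_sub_pos {θ x : ℝ} {k : ℤ}
    (hx : x ∈ Ioo (zeroEndpoint θ k) (zeroEndpoint θ (k + 1))) :
    0 < (-1 : ℝ) ^ k * Real.cos (x - θ) := by
  rw [← Real.cos_sub_int_mul_pi]
  have h1 := hx.1
  have h2 := hx.2
  simp only [zeroEndpoint] at h1 h2
  push_cast at h2
  exact Real.cos_pos_of_mem_Ioo ⟨by linarith, by linarith⟩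

lemma zeroEndpoint_lt (θ : ℝ) (k : ℤ) : zeroEndpoint θ k < zeroEndpoint θ (k + 1) := by
  simp only [zeroEndpoint]
  push_cast
  linarith [Real.pi_pos]

lemma cos_zeroEndpoint_sub (θ : ℝ) (k : ℤ) : Real.cos (zeroEndpoint θ k - θ) = 0 := by
  rw [zeroEndpoint, show ((k : ℝ) - 1 / 2) * Real.pi + θ - θ = k * Real.pi - Real.pi / 2 by ring,
    Real.cos_sub_pi_div_two, Real.sin_int_mul_pi]

lemma sin_zeroEndpoint_sub (θ : ℝ) (k : ℤ) :
    Real.sin (zeroEndpoint θ k - θ) = -(-1 : ℝ) ^ k := by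
  rw [zeroEndpoint, show ((k : ℝ) - 1 / 2) * Real.pi + θ - θ = k * Real.pi - Real.pi / 2 by ring,
    Real.sin_sub_pi_div_two, Real.cos_int_mul_pi]

lemma neg_one_zpow_mul_self (k : ℤ) : (-1 : ℝ) ^ k * (-1 : ℝ) ^ k = 1 := by
  rw [← mul_zpow]
  norm_num

lemma exists_mem_Ioo_zeroEndpoint {θ x : ℝ} (h : Real.cos (x - θ) ≠ 0) :
    ∃ k : ℤ, x ∈ Ioo (zeroEndpoint θ k) (zeroEndpoint θ (k + 1)) := by
  have hpi := Real.pi_pos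
  set k := ⌊(x - θ) / Real.pi + 1 / 2⌋ with hk
  have h1 : (k : ℝ) ≤ (x - θ) / Real.pi + 1 / 2 := Int.floor_le _
  have h2 : (x - θ) / Real.pi + 1 / 2 < k + 1 := Int.lt_floor_add_one _
  have h1' : ((k : ℝ) - 1 / 2) * Real.pi ≤ x - θ := by
    rw [← le_div_iff₀ hpi]
    linarith
  have h2' : x - θ < ((k : ℝ) + 1 / 2) * Real.pi := by
    rw [← div_lt_iff₀ hpi]
    linarith
  refine ⟨k, lt_of_le_of_ne ?_ ?_, ?_⟩
  · rw [zeroEndpoint]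
    linarith
  · intro he
    rw [← he] at h
    exact h (cos_zeroEndpoint_sub θ k)
  · rw [zeroEndpoint]
    push_cast
    linarith

lemma hasDerivAt_re_cosTransform {f : ℝ → ℝ} (hf : IntegrableOn f (Ioo 0 1)) (θ x : ℝ) :
    HasDerivAt (fun x : ℝ => (cosTransform f θ x).re) (deriv (cosTransform f θ) x).re x :=
  (differentiable_cosTransform hf θ x).hasDerivAt.real_of_complex

lemma cosTransform_ofReal_eq_zero_iff (f : ℝ → ℝ) (θ x : ℝ) :
    cosTransform f θ x = 0 ↔ (cosTransform f θ x).re = 0 :=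
  ⟨fun h => by rw [h, Complex.zero_re],
    fun h => Complex.ext h (cosTransform_ofReal_im f θ x)⟩

lemma IsIncreasingWeight.exists_mem_Ioo {f : ℝ → ℝ} {c : ℝ} (hf : IsIncreasingWeight f c)
    (θ : ℝ) {x : ℝ} (hx0 : x ≠ 0) (hx : cosTransform f θ x = 0) :
    ∃ k : ℤ, x ∈ Ioo (zeroEndpoint θ k) (zeroEndpoint θ (k + 1)) := by
  refine exists_mem_Ioo_zeroEndpoint fun h => ?_
  have := hf.mul_sin_mul_pos θ hx0 h
  rw [hx, Complex.zero_re, mul_zero] at this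
  exact lt_irrefl _ this

/-- With `σ = (-1)^k` the sign of `cos(x - θ)` on the interval and `ε` the sign of `x` there, `ε σ
F` is negative at the left end, positive at the right end, and crosses zero only upwards. -/
lemma IsIncreasingWeight.existsUnique_zero {f : ℝ → ℝ} {c : ℝ} (hf : IsIncreasingWeight f c)
    (θ : ℝ) {k : ℤ} (hk : (0 : ℝ) ∉ Icc (zeroEndpoint θ k) (zeroEndpoint θ (k + 1))) :
    ∃! x : ℝ, x ∈ Ioo (zeroEndpoint θ k) (zeroEndpoint θ (k + 1)) ∧ cosTransform f θ x = 0 := by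
  set a := zeroEndpoint θ k with ha
  set b := zeroEndpoint θ (k + 1) with hb
  have hab : a < b := zeroEndpoint_lt θ k
  set σ : ℝ := (-1) ^ k with hσ
  have hσ2 : σ * σ = 1 := neg_one_zpow_mul_self k
  have hsa : Real.sin (a - θ) = -σ := sin_zeroEndpoint_sub θ k
  have hsb : Real.sin (b - θ) = σ := by
    rw [hb, sin_zeroEndpoint_sub, zpow_add_one₀ (by norm_num)]
    ring
  obtain ⟨ε, hε2, hε⟩ : ∃ ε : ℝ, ε * ε = 1 ∧ ∀ x ∈ Icc a b, 0 < ε * x := by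
    rcases lt_or_ge 0 a with h | h
    · exact ⟨1, by norm_num, fun x hx => by linarith [hx.1]⟩
    · have hb0 : b < 0 := not_le.1 fun h' => hk ⟨h, h'⟩
      exact ⟨-1, by norm_num, fun x hx => by linarith [hx.2]⟩
  have hε0 : ε ≠ 0 := fun h => by norm_num [h] at hε2
  have hσ0 : σ ≠ 0 := fun h => by norm_num [h] at hσ2
  have hne : ∀ x ∈ Icc a b, x ≠ 0 := fun x hx h => by simpa [h] using hε x hx
  have hval : ∀ x ∈ Icc a b, ∀ s t : ℝ, 0 < x * s * t → 0 < ε * s * t := by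
    intro x hx s t h
    have h1 := mul_pos h (hε x hx)
    have h2 : x * s * t * (ε * x) = ε * s * t * x ^ 2 := by ring
    rw [h2] at h1
    exact pos_of_mul_pos_left h1 (sq_nonneg x)
  have key := existsUnique_zero_of_deriv_pos (ψ := fun x => ε * σ * (cosTransform f θ x).re)
    (ψ' := fun x => ε * σ * (deriv (cosTransform f θ) x).re) hab
    (fun x => (hasDerivAt_re_cosTransform hf.integrableOn θ x).const_mul _)
    (by
      have ham : a ∈ Icc a b := ⟨le_rfl, hab.le⟩
      have := hval a ham _ _ (hf.mul_sin_mul_pos θ (hne a ham) (cos_zeroEndpoint_sub θ k))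
      rw [hsa] at this
      linarith)
    (by
      have hbm : b ∈ Icc a b := ⟨hab.le, le_rfl⟩
      have := hval b hbm _ _ (hf.mul_sin_mul_pos θ (hne b hbm) (cos_zeroEndpoint_sub θ (k + 1)))
      rwa [hsb] at this)
    (fun x hx h => by
      have hxm := Ioo_subset_Icc_self hx
      have h0 : cosTransform f θ x = 0 := (cosTransform_ofReal_eq_zero_iff f θ x).2
        ((mul_eq_zero.1 h).resolve_left (mul_ne_zero hε0 hσ0))
      have h1 := hval x hxm _ _ (hf.mul_cos_mul_deriv_pos θ (hne x hxm) h0)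
      have h2 : 0 < σ * Real.cos (x - θ) := sign_mul_cos_sub_pos hx
      have h3 : ε * Real.cos (x - θ) * (deriv (cosTransform f θ) x).re =
          (σ * Real.cos (x - θ)) * (ε * σ * (deriv (cosTransform f θ) x).re) := by
        linear_combination (-ε * Real.cos (x - θ) * (deriv (cosTransform f θ) x).re) * hσ2
      rw [h3] at h1
      exact pos_of_mul_pos_right h1 h2.le)
  refine (existsUnique_congr fun x => and_congr_right fun _ => ?_).1 key
  rw [cosTransform_ofReal_eq_zero_iff, mul_eq_zero, or_iff_right (mul_ne_zero hε0 hσ0)]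

/-- For `0 < t < 1` the point `xt` lies between `0` and `x`, hence stays in the open interval, where
`cos(· - θ)` has the constant sign `(-1)^k`; a positive weight cannot make the integral vanish. -/
lemma IsIncreasingWeight.ne_zero_of_zero_mem {f : ℝ → ℝ} {c : ℝ} (hf : IsIncreasingWeight f c)
    (θ : ℝ) {k : ℤ} (hk : (0 : ℝ) ∈ Icc (zeroEndpoint θ k) (zeroEndpoint θ (k + 1))) {x : ℝ}
    (hx : x ∈ Ioo (zeroEndpoint θ k) (zeroEndpoint θ (k + 1))) : cosTransform f θ x ≠ 0 := by
  have hpos : ∀ t ∈ Ioo (0 : ℝ) 1, 0 < f t * ((-1 : ℝ) ^ k * Real.cos (x * t - θ)) := by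
    intro t ht
    refine mul_pos ((mul_pos hf.pos (pow_pos ht.1 2)).trans_le (hf.le t ht))
      (sign_mul_cos_sub_pos ⟨?_, ?_⟩)
    · nlinarith [hx.1, hk.1, ht.1, ht.2]
    · nlinarith [hx.2, hk.2, ht.1, ht.2]
  have hint : 0 < ∫ t in Ioo (0 : ℝ) 1, f t * ((-1 : ℝ) ^ k * Real.cos (x * t - θ)) := by
    rw [setIntegral_pos_iff_support_of_nonneg_ae
      ((ae_restrict_iff' measurableSet_Ioo).2 (.of_forall fun t ht => (hpos t ht).le))
      (hf.integrableOn.mul_continuous_Ioo (by fun_prop))]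
    have : Ioo (0 : ℝ) 1 ⊆ (Function.support fun t =>
        f t * ((-1 : ℝ) ^ k * Real.cos (x * t - θ))) ∩ Ioo 0 1 :=
      fun t ht => ⟨(hpos t ht).ne', ht⟩
    exact lt_of_lt_of_le (by simp) (measure_mono this)
  intro h
  rw [cosTransform_ofReal, Complex.ofReal_eq_zero] at h
  simp_rw [mul_left_comm (f _)] at hint
  rw [integral_const_mul, h, mul_zero] at hint
  exact lt_irrefl _ hint

lemma IsIncreasingWeight.cosTransform_zero_eq_zero_iff {f : ℝ → ℝ} {c : ℝ}
    (hf : IsIncreasingWeight f c) {θ : ℝ} (hθ : θ ∈ Icc 0 Real.pi) :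
    cosTransform f θ 0 = 0 ↔ θ = Real.pi / 2 := by
  have h := cosTransform_ofReal f θ 0
  simp only [Complex.ofReal_zero, zero_mul, zero_sub, Real.cos_neg] at h
  rw [h, integral_mul_const, Complex.ofReal_eq_zero, mul_eq_zero,
    or_iff_right hf.integral_pos.ne']
  constructor
  · intro hc
    refine Real.injOn_cos hθ ⟨by positivity, by linarith [Real.pi_pos]⟩ ?_
    rw [hc, Real.cos_pi_div_two]
  · rintro rfl
    exact Real.cos_pi_div_two

/-! ### The beta weight: moments and monotonicity -/

lemma lintegral_Ioo_affine {r : ℝ} (hr : 0 < r) (a : ℝ) (g : ℝ → ENNReal) :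
    ∫⁻ x in Ioo a (a + r), g x = ∫⁻ w in Ioo (0 : ℝ) 1, ENNReal.ofReal r * g (a + r * w) := by
  have himg : (fun w => a + r * w) '' Ioo 0 1 = Ioo a (a + r) := by
    ext x
    constructor
    · rintro ⟨w, hw, rfl⟩
      exact ⟨by nlinarith [hw.1], by nlinarith [hw.2]⟩
    · intro hx
      refine ⟨(x - a) / r, ⟨div_pos (by linarith [hx.1]) hr, ?_⟩, by field_simp; ring⟩
      rw [div_lt_one hr]
      linarith [hx.2]
  rw [← himg, lintegral_image_eq_lintegral_abs_deriv_mul measurableSet_Ioo (f' := fun _ => r)]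
  · simp only [abs_of_pos hr]
  · intro x _
    have := ((hasDerivAt_id x).const_mul r).const_add a
    simpa using this.hasDerivWithinAt
  · intro x _ y _ h
    simpa [hr.ne'] using h

lemma lintegral_Ioo_sq (g : ℝ → ENNReal) :
    ∫⁻ u in Ioo (0 : ℝ) 1, g u = ∫⁻ t in Ioo (0 : ℝ) 1, ENNReal.ofReal (2 * t) * g (t ^ 2) := by
  have himg : (fun t : ℝ => t ^ 2) '' Ioo 0 1 = Ioo 0 1 := by
    ext x
    constructor
    · rintro ⟨t, ht, rfl⟩
      exact ⟨pow_pos ht.1 2, pow_lt_one₀ ht.1.le ht.2 two_ne_zero⟩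
    · intro hx
      exact ⟨√x, ⟨Real.sqrt_pos.2 hx.1, (Real.sqrt_lt' one_pos).2 (by simpa using hx.2)⟩,
        Real.sq_sqrt hx.1.le⟩
  conv_lhs => rw [← himg]
  rw [lintegral_image_eq_lintegral_abs_deriv_mul measurableSet_Ioo (f' := fun t => 2 * t)]
  · refine setLIntegral_congr_fun measurableSet_Ioo fun t ht => ?_
    rw [abs_of_pos (by linarith [ht.1])]
  · intro x _
    simpa using (hasDerivAt_pow 2 x).hasDerivWithinAt
  · intro x hx y hy h
    exact (pow_left_inj₀ hx.1.le hy.1.le two_ne_zero).1 h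

open ProbabilityTheory in
lemma lintegral_rpow_mul_one_sub_rpow {a b : ℝ} (ha : 0 < a) (hb : 0 < b) :
    ∫⁻ x in Ioo (0 : ℝ) 1, ENNReal.ofReal (x ^ (a - 1) * (1 - x) ^ (b - 1)) =
      ENNReal.ofReal (beta a b) := by
  have h := lintegral_betaPDF_eq_one ha hb
  have hB := beta_pos ha hb
  rw [lintegral_betaPDF] at h
  have e : ∀ x : ℝ, ENNReal.ofReal (1 / beta a b * x ^ (a - 1) * (1 - x) ^ (b - 1)) =
      ENNReal.ofReal (1 / beta a b) * ENNReal.ofReal (x ^ (a - 1) * (1 - x) ^ (b - 1)) := by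
    intro x
    rw [← ENNReal.ofReal_mul (by positivity), mul_assoc]
  simp_rw [e] at h
  rw [lintegral_const_mul _ (by fun_prop)] at h
  have h2 := congrArg (fun y => ENNReal.ofReal (beta a b) * y) h
  simp only [mul_one] at h2
  rwa [← mul_assoc, ← ENNReal.ofReal_mul hB.le, mul_one_div_cancel hB.ne', ENNReal.ofReal_one,
    one_mul] at h2

lemma lintegral_Ioo_rpow_mul_sub_rpow {s a v : ℝ} (hs : 0 < s) (ha : 0 < a) (hv : 0 < v) :
    ∫⁻ u in Ioo 0 v, ENNReal.ofReal (u ^ (s - 1) * (v - u) ^ (a - 1)) =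
      ENNReal.ofReal (v ^ (s + a - 1)) * ENNReal.ofReal (ProbabilityTheory.beta s a) := by
  have h := lintegral_Ioo_affine hv 0 fun u => ENNReal.ofReal (u ^ (s - 1) * (v - u) ^ (a - 1))
  rw [zero_add] at h
  rw [h, ← lintegral_rpow_mul_one_sub_rpow hs ha, ← lintegral_const_mul _ (by fun_prop)]
  refine setLIntegral_congr_fun measurableSet_Ioo fun w hw => ?_
  rw [← ENNReal.ofReal_mul hv.le, ← ENNReal.ofReal_mul (by positivity), zero_add,
    Real.mul_rpow hv.le hw.1.le, show v - v * w = v * (1 - w) by ring,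
    Real.mul_rpow hv.le (by linarith [hw.2]), show s + a - 1 = 1 + (s - 1) + (a - 1) by ring,
    Real.rpow_add hv, Real.rpow_add hv, Real.rpow_one]
  congr 1
  ring

/-- Exchange of the order of integration over the triangle `0 < u < v < 1`. -/
lemma lintegral_triangle_swap {Φ : ℝ → ℝ → ENNReal} (hΦ : Measurable (Function.uncurry Φ)) :
    ∫⁻ u in Ioo (0 : ℝ) 1, ∫⁻ v in Ioo u 1, Φ u v =
      ∫⁻ v in Ioo (0 : ℝ) 1, ∫⁻ u in Ioo 0 v, Φ u v := by
  have hT : MeasurableSet {p : ℝ × ℝ | p.1 < p.2} := measurableSet_lt measurable_fst measurable_snd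
  have h := lintegral_lintegral_swap (μ := volume.restrict (Ioo (0 : ℝ) 1))
    (ν := volume.restrict (Ioo (0 : ℝ) 1))
    (f := fun u v => ({p : ℝ × ℝ | p.1 < p.2}.indicator (Function.uncurry Φ)) (u, v))
    (hΦ.indicator hT).aemeasurable
  have e1 : ∀ u ∈ Ioo (0 : ℝ) 1, ∫⁻ v in Ioo (0 : ℝ) 1,
      ({p : ℝ × ℝ | p.1 < p.2}.indicator (Function.uncurry Φ)) (u, v) =
      ∫⁻ v in Ioo u 1, Φ u v := by
    intro u hu
    have : Ioo u 1 = Ioi u ∩ Ioo 0 1 := by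
      ext v
      exact ⟨fun hv => ⟨hv.1, hu.1.trans hv.1, hv.2⟩, fun hv => ⟨hv.1, hv.2.2⟩⟩
    rw [this, ← setLIntegral_indicator measurableSet_Ioi]
    rfl
  have e2 : ∀ v ∈ Ioo (0 : ℝ) 1, ∫⁻ u in Ioo (0 : ℝ) 1,
      ({p : ℝ × ℝ | p.1 < p.2}.indicator (Function.uncurry Φ)) (u, v) =
      ∫⁻ u in Ioo 0 v, Φ u v := by
    intro v hv
    have : Ioo 0 v = Iio v ∩ Ioo 0 1 := by
      ext u
      exact ⟨fun hu => ⟨hu.2, hu.1, hu.2.trans hv.2⟩, fun hu => ⟨hu.2.1, hu.1⟩⟩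
    rw [this, ← setLIntegral_indicator measurableSet_Iio]
    rfl
  rw [setLIntegral_congr_fun measurableSet_Ioo e1, setLIntegral_congr_fun measurableSet_Ioo e2] at h
  exact h

/-- The integral `∫₀¹ w^{α-1} (1-w)^{β-1} (w + (1-w)u)^{1/2-α} dw`; times `(1-u)^{α+β-1}`, it is,
in the variable `u = t²`, the multiplicative convolution of two beta densities. -/
noncomputable def betaKernel (α β u : ℝ) : ℝ :=
  ∫ w in Ioo (0 : ℝ) 1, w ^ (α - 1) * (1 - w) ^ (β - 1) * (w + (1 - w) * u) ^ (1 / 2 - α)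

lemma integrableOn_rpow_mul_one_sub_rpow {a b : ℝ} (ha : 0 < a) (hb : 0 < b) :
    IntegrableOn (fun x : ℝ => x ^ (a - 1) * (1 - x) ^ (b - 1)) (Ioo 0 1) := by
  refine (lintegral_ofReal_ne_top_iff_integrable (by fun_prop)
    ((ae_restrict_iff' measurableSet_Ioo).2 (.of_forall fun x hx => ?_))).1 ?_
  · exact mul_nonneg (Real.rpow_nonneg hx.1.le _) (Real.rpow_nonneg (by linarith [hx.2]) _)
  · rw [lintegral_rpow_mul_one_sub_rpow ha hb]
    exact ENNReal.ofReal_ne_top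

section betaKernel

variable {α β : ℝ}

lemma betaKernel_base_mem {u w : ℝ} (hu : u ∈ Ico (0 : ℝ) 1) (hw : w ∈ Ioo (0 : ℝ) 1) :
    0 < w + (1 - w) * u ∧ w + (1 - w) * u ≤ 1 := by
  constructor <;> nlinarith [hu.1, hu.2, hw.1, hw.2]

lemma integrableOn_betaKernel (hα : 0 < α) (hα' : α < 1 / 2) (hβ : 0 < β) {u : ℝ}
    (hu : u ∈ Ico (0 : ℝ) 1) : IntegrableOn (fun w : ℝ =>
      w ^ (α - 1) * (1 - w) ^ (β - 1) * (w + (1 - w) * u) ^ (1 / 2 - α)) (Ioo 0 1) := by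
  refine Integrable.mul_bdd (c := 1) (integrableOn_rpow_mul_one_sub_rpow hα hβ)
    (Measurable.aestronglyMeasurable (by fun_prop)) ?_
  refine (ae_restrict_iff' measurableSet_Ioo).2 (.of_forall fun w hw => ?_)
  obtain ⟨h1, h2⟩ := betaKernel_base_mem hu hw
  rw [Real.norm_of_nonneg (Real.rpow_nonneg h1.le _)]
  exact Real.rpow_le_one h1.le h2 (by linarith)

lemma rpow_mul_one_sub_rpow_pos {a b w : ℝ} (hw : w ∈ Ioo (0 : ℝ) 1) :
    0 < w ^ a * (1 - w) ^ b :=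
  mul_pos (Real.rpow_pos_of_pos hw.1 _) (Real.rpow_pos_of_pos (by linarith [hw.2]) _)

/-- Only the base `w + (1 - w)u` depends on `u`, and `α < 1/2` makes its exponent positive. The
point `u = 0` is included because `betaKernel α β 0` enters the constant of the weight. -/
lemma betaKernel_mono (hα : 0 < α) (hα' : α < 1 / 2) (hβ : 0 < β) :
    MonotoneOn (betaKernel α β) (Ico 0 1) := by
  intro s hs t ht hst
  refine setIntegral_mono_on (integrableOn_betaKernel hα hα' hβ hs)
    (integrableOn_betaKernel hα hα' hβ ht) measurableSet_Ioo fun w hw => ?_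
  refine mul_le_mul_of_nonneg_left ?_ (rpow_mul_one_sub_rpow_pos hw).le
  refine Real.rpow_le_rpow (betaKernel_base_mem hs hw).1.le ?_ (by linarith)
  nlinarith [hw.2]

lemma betaKernel_zero_pos (hα : 0 < α) (hα' : α < 1 / 2) (hβ : 0 < β) : 0 < betaKernel α β 0 := by
  have h0 : (0 : ℝ) ∈ Ico (0 : ℝ) 1 := ⟨le_rfl, one_pos⟩
  have hpos : ∀ w ∈ Ioo (0 : ℝ) 1,
      0 < w ^ (α - 1) * (1 - w) ^ (β - 1) * (w + (1 - w) * 0) ^ (1 / 2 - α) := fun w hw =>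
    mul_pos (rpow_mul_one_sub_rpow_pos hw) (Real.rpow_pos_of_pos (betaKernel_base_mem h0 hw).1 _)
  rw [betaKernel, setIntegral_pos_iff_support_of_nonneg_ae
    ((ae_restrict_iff' measurableSet_Ioo).2 (.of_forall fun w hw => (hpos w hw).le))
    (integrableOn_betaKernel hα hα' hβ h0)]
  have : Ioo (0 : ℝ) 1 ⊆ (Function.support fun w : ℝ =>
      w ^ (α - 1) * (1 - w) ^ (β - 1) * (w + (1 - w) * 0) ^ (1 / 2 - α)) ∩ Ioo 0 1 :=
    fun w hw => ⟨(hpos w hw).ne', hw⟩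
  exact lt_of_lt_of_le (by simp) (measure_mono this)

/-- Substitution `v = u + (1 - u)w`, giving the convolution form in which the order of integration
can be exchanged. -/
lemma ofReal_rpow_mul_betaKernel (hα : 0 < α) (hα' : α < 1 / 2) (hβ : 0 < β) {u : ℝ}
    (hu : u ∈ Ioo (0 : ℝ) 1) :
    ENNReal.ofReal ((1 - u) ^ (α + β - 1) * betaKernel α β u) =
      ∫⁻ v in Ioo u 1,
        ENNReal.ofReal ((1 - v) ^ (β - 1) * v ^ (1 / 2 - α) * (v - u) ^ (α - 1)) := by
  have hu' : 0 < 1 - u := by linarith [hu.2]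
  have h := lintegral_Ioo_affine hu' u fun v =>
    ENNReal.ofReal ((1 - v) ^ (β - 1) * v ^ (1 / 2 - α) * (v - u) ^ (α - 1))
  rw [add_sub_cancel] at h
  have hI : u ∈ Ico (0 : ℝ) 1 := Ioo_subset_Ico_self hu
  rw [h, ENNReal.ofReal_mul (by positivity), betaKernel, ofReal_integral_eq_lintegral_ofReal
    (integrableOn_betaKernel hα hα' hβ hI) ((ae_restrict_iff' measurableSet_Ioo).2
      (.of_forall fun w hw => mul_nonneg (rpow_mul_one_sub_rpow_pos hw).le
        (Real.rpow_nonneg (betaKernel_base_mem hI hw).1.le _))),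
    ← lintegral_const_mul _ (by fun_prop)]
  refine setLIntegral_congr_fun measurableSet_Ioo fun w hw => ?_
  rw [← ENNReal.ofReal_mul (by positivity), ← ENNReal.ofReal_mul hu'.le,
    show 1 - (u + (1 - u) * w) = (1 - u) * (1 - w) by ring,
    show u + (1 - u) * w - u = (1 - u) * w by ring,
    show u + (1 - u) * w = w + (1 - w) * u by ring,
    Real.mul_rpow hu'.le (by linarith [hw.2]), Real.mul_rpow hu'.le hw.1.le,
    show α + β - 1 = 1 + (β - 1) + (α - 1) by ring, Real.rpow_add hu', Real.rpow_add hu',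
    Real.rpow_one]
  congr 1
  ring

/-- After exchanging the integrals, the inner one is `v^{s+α-1} B(s, α)`. The factor `v^{1/2-α}`
turns this power into `v^{s-1/2}`, which is why the second beta function sits at `s + 1/2`. -/
lemma lintegral_rpow_mul_betaKernel (hα : 0 < α) (hα' : α < 1 / 2) (hβ : 0 < β) {s : ℝ}
    (hs : 0 < s) :
    ∫⁻ u in Ioo (0 : ℝ) 1,
        ENNReal.ofReal (u ^ (s - 1) * ((1 - u) ^ (α + β - 1) * betaKernel α β u)) =
      ENNReal.ofReal (ProbabilityTheory.beta s α * ProbabilityTheory.beta (s + 1 / 2) β) := by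
  have e1 : ∀ u ∈ Ioo (0 : ℝ) 1,
      ENNReal.ofReal (u ^ (s - 1) * ((1 - u) ^ (α + β - 1) * betaKernel α β u)) =
      ∫⁻ v in Ioo u 1, ENNReal.ofReal ((1 - v) ^ (β - 1) * v ^ (1 / 2 - α)) *
        ENNReal.ofReal (u ^ (s - 1) * (v - u) ^ (α - 1)) := by
    intro u hu
    have hu0 := Real.rpow_nonneg hu.1.le (s - 1)
    rw [ENNReal.ofReal_mul hu0, ofReal_rpow_mul_betaKernel hα hα' hβ hu,
      ← lintegral_const_mul _ (by fun_prop)]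
    refine setLIntegral_congr_fun measurableSet_Ioo fun v hv => ?_
    have hv0 : 0 < v := hu.1.trans hv.1
    rw [← ENNReal.ofReal_mul hu0, ← ENNReal.ofReal_mul (mul_nonneg
      (Real.rpow_nonneg (by linarith [hv.2]) _) (Real.rpow_nonneg hv0.le _))]
    congr 1
    ring
  rw [setLIntegral_congr_fun measurableSet_Ioo e1, lintegral_triangle_swap (by fun_prop)]
  have e2 : ∀ v ∈ Ioo (0 : ℝ) 1,
      ∫⁻ u in Ioo 0 v, ENNReal.ofReal ((1 - v) ^ (β - 1) * v ^ (1 / 2 - α)) *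
        ENNReal.ofReal (u ^ (s - 1) * (v - u) ^ (α - 1)) =
      ENNReal.ofReal (ProbabilityTheory.beta s α) *
        ENNReal.ofReal (v ^ (s + 1 / 2 - 1) * (1 - v) ^ (β - 1)) := by
    intro v hv
    have hv1 : 0 ≤ (1 - v) ^ (β - 1) := Real.rpow_nonneg (by linarith [hv.2]) _
    have hv2 : 0 ≤ v ^ (1 / 2 - α) := Real.rpow_nonneg hv.1.le _
    rw [lintegral_const_mul _ (by fun_prop), lintegral_Ioo_rpow_mul_sub_rpow hs hα hv.1,
      ← mul_assoc, ← ENNReal.ofReal_mul (mul_nonneg hv1 hv2), mul_comm]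
    congr 2
    rw [mul_assoc, ← Real.rpow_add hv.1, mul_comm]
    congr 2
    ring
  rw [setLIntegral_congr_fun measurableSet_Ioo e2, lintegral_const_mul _ (by fun_prop),
    lintegral_rpow_mul_one_sub_rpow (by linarith) hβ,
    ← ENNReal.ofReal_mul (ProbabilityTheory.beta_pos hs hα).le]

/-- The weight on `(0, 1)` whose moments are products of two beta functions. -/
noncomputable def betaWeight (α β t : ℝ) : ℝ :=
  (1 - t ^ 2) ^ (α + β - 1) * betaKernel α β (t ^ 2)

lemma sq_mem_Ioo {t : ℝ} (ht : t ∈ Ioo (0 : ℝ) 1) : t ^ 2 ∈ Ioo (0 : ℝ) 1 :=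
  ⟨pow_pos ht.1 2, pow_lt_one₀ ht.1.le ht.2 two_ne_zero⟩

lemma betaKernel_zero_le (hα : 0 < α) (hα' : α < 1 / 2) (hβ : 0 < β) {u : ℝ}
    (hu : u ∈ Ico (0 : ℝ) 1) : betaKernel α β 0 ≤ betaKernel α β u :=
  betaKernel_mono hα hα' hβ ⟨le_rfl, one_pos⟩ hu hu.1

lemma betaWeight_pos (hα : 0 < α) (hα' : α < 1 / 2) (hβ : 0 < β) {t : ℝ}
    (ht : t ∈ Ioo (0 : ℝ) 1) : 0 < betaWeight α β t := by
  have h := sq_mem_Ioo ht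
  exact mul_pos (Real.rpow_pos_of_pos (by linarith [h.2]) _)
    ((betaKernel_zero_pos hα hα' hβ).trans_le
      (betaKernel_zero_le hα hα' hβ (Ioo_subset_Ico_self h)))

lemma lintegral_pow_mul_betaWeight (hα : 0 < α) (hα' : α < 1 / 2) (hβ : 0 < β) (m : ℕ) :
    ∫⁻ t in Ioo (0 : ℝ) 1, ENNReal.ofReal (t ^ m * betaWeight α β t) =
      ENNReal.ofReal (ProbabilityTheory.beta ((m + 1) / 2) α *
        ProbabilityTheory.beta ((m + 1) / 2 + 1 / 2) β / 2) := by
  have hs : (0 : ℝ) < (m + 1) / 2 := by positivity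
  have h := lintegral_rpow_mul_betaKernel hα hα' hβ hs
  rw [lintegral_Ioo_sq] at h
  have e : ∀ t ∈ Ioo (0 : ℝ) 1, ENNReal.ofReal (2 * t) * ENNReal.ofReal
      ((t ^ 2) ^ (((m : ℝ) + 1) / 2 - 1) *
        ((1 - t ^ 2) ^ (α + β - 1) * betaKernel α β (t ^ 2))) =
      ENNReal.ofReal 2 * ENNReal.ofReal (t ^ m * betaWeight α β t) := by
    intro t ht
    rw [← ENNReal.ofReal_mul (by linarith [ht.1]), ← ENNReal.ofReal_mul (by norm_num), betaWeight]
    have h1 : (t ^ 2) ^ (((m : ℝ) + 1) / 2 - 1) * t = t ^ m := by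
      rw [← Real.rpow_natCast t 2, ← Real.rpow_mul ht.1.le, ← Real.rpow_natCast t m]
      nth_rewrite 2 [← Real.rpow_one t]
      rw [← Real.rpow_add ht.1]
      congr 1
      push_cast
      ring
    rw [← h1]
    congr 1
    ring
  rw [setLIntegral_congr_fun measurableSet_Ioo e, lintegral_const_mul' _ _ ENNReal.ofReal_ne_top]
    at h
  have h2 := congrArg (fun y => ENNReal.ofReal (1 / 2) * y) h
  rw [← mul_assoc, ← ENNReal.ofReal_mul (by norm_num), ← ENNReal.ofReal_mul (by norm_num)] at h2
  norm_num at h2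
  rw [h2, ← ENNReal.ofReal_mul (by norm_num)]
  congr 1
  ring

/-- A quantitative form of the monotonicity of `x ↦ x^{-γ}` on `(0, 1]`. -/
lemma mul_sub_le_rpow_neg_sub_rpow_neg {γ x y : ℝ} (hγ : 0 ≤ γ) (hy : 0 < y) (hyx : y ≤ x)
    (hx : x ≤ 1) : γ * (x - y) ≤ y ^ (-γ) - x ^ (-γ) := by
  have hx0 : 0 < x := hy.trans_le hyx
  have hr : 0 < y / x := div_pos hy hx0
  -- Combines `e^y ≥ 1 + y` with `log r ≤ r - 1` for `r = y / x`.
  have h1 : 1 + γ * (1 - y / x) ≤ (y / x) ^ (-γ) := by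
    rw [Real.rpow_def_of_pos hr]
    have h2 := Real.add_one_le_exp (Real.log (y / x) * -γ)
    have h3 := Real.log_le_sub_one_of_pos hr
    nlinarith
  have h4 : y ^ (-γ) = x ^ (-γ) * (y / x) ^ (-γ) := by
    rw [← Real.mul_rpow hx0.le hr.le, mul_div_cancel₀ _ hx0.ne']
  have h5 : 1 ≤ x ^ (-γ) := Real.one_le_rpow_of_pos_of_le_one_of_nonpos hx0 hx (by linarith)
  have h6 : x - y ≤ 1 - y / x := by
    rw [one_sub_div hx0.ne', le_div_iff₀ hx0]
    nlinarith
  have h7 : γ * (x - y) ≤ γ * (1 - y / x) := mul_le_mul_of_nonneg_left h6 hγ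
  have h8 : 0 ≤ γ * (x - y) := mul_nonneg hγ (by linarith)
  rw [h4]
  nlinarith

/-- The factor `(1 - t²)^{-(1-α-β)}` gains at least `(1-α-β)(t² - s²)` from `s` to `t`, and it
multiplies an increasing kernel bounded below by its value at `0`. The condition `α + β < 1` is what
makes the gain strictly positive. -/
lemma betaWeight_monotoneOn (hα : 0 < α) (hα' : α < 1 / 2) (hβ : 0 < β) (hαβ : α + β < 1) :
    MonotoneOn (fun t => betaWeight α β t - (1 - α - β) * betaKernel α β 0 * t ^ 2)
      (Ioo 0 1) := by
  intro s hs t ht hst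
  have hs2 := sq_mem_Ioo hs
  have ht2 := sq_mem_Ioo ht
  have hle : s ^ 2 ≤ t ^ 2 := pow_le_pow_left₀ hs.1.le hst 2
  have h0 := betaKernel_zero_pos hα hα' hβ
  have h1 := betaKernel_zero_le hα hα' hβ (Ioo_subset_Ico_self hs2)
  have h2 := betaKernel_mono hα hα' hβ (Ioo_subset_Ico_self hs2) (Ioo_subset_Ico_self ht2) hle
  have h3 := mul_sub_le_rpow_neg_sub_rpow_neg (γ := 1 - α - β) (x := 1 - s ^ 2) (y := 1 - t ^ 2)
    (by linarith) (by linarith [ht2.2]) (by linarith) (by linarith [hs2.1])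
  have h4 : 0 < (1 - t ^ 2) ^ (-(1 - α - β)) := Real.rpow_pos_of_pos (by linarith [ht2.2]) _
  simp only [betaWeight]
  rw [show α + β - 1 = -(1 - α - β) by ring]
  have h5 : 0 ≤ (1 - α - β) * (t ^ 2 - s ^ 2) :=
    mul_nonneg (by linarith) (by linarith)
  have h3' : (1 - α - β) * (t ^ 2 - s ^ 2) ≤
      (1 - t ^ 2) ^ (-(1 - α - β)) - (1 - s ^ 2) ^ (-(1 - α - β)) := by
    linarith
  have h6 := mul_le_mul_of_nonneg_left h2 h4.le
  have h7 := mul_le_mul h3' h1 h0.le (h5.trans h3')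
  linarith

lemma betaWeight_ge (hα : 0 < α) (hα' : α < 1 / 2) (hβ : 0 < β) (hαβ : α + β < 1) {t : ℝ}
    (ht : t ∈ Ioo (0 : ℝ) 1) :
    (1 - α - β) * betaKernel α β 0 * t ^ 2 ≤ betaWeight α β t := by
  have ht2 := sq_mem_Ioo ht
  have h0 := betaKernel_zero_pos hα hα' hβ
  have h1 := betaKernel_zero_le hα hα' hβ (Ioo_subset_Ico_self ht2)
  have h3 := mul_sub_le_rpow_neg_sub_rpow_neg (γ := 1 - α - β) (x := 1) (y := 1 - t ^ 2)
    (by linarith) (by linarith [ht2.2]) (by linarith [ht2.1]) le_rfl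
  rw [Real.one_rpow] at h3
  have h4 : (1 - α - β) * t ^ 2 ≤ (1 - t ^ 2) ^ (-(1 - α - β)) := by linarith
  have h5 : 0 < (1 - t ^ 2) ^ (-(1 - α - β)) := Real.rpow_pos_of_pos (by linarith [ht2.2]) _
  rw [betaWeight, show α + β - 1 = -(1 - α - β) by ring]
  have := mul_le_mul h4 h1 h0.le h5.le
  linarith

lemma betaWeight_integrableOn (hα : 0 < α) (hα' : α < 1 / 2) (hβ : 0 < β) (hαβ : α + β < 1) :
    IntegrableOn (betaWeight α β) (Ioo 0 1) := by
  -- Measurability comes from monotonicity after subtracting the quadratic term, not from the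
  -- parametric integral.
  have hm : AEMeasurable (betaWeight α β) (volume.restrict (Ioo 0 1)) := by
    have h := (aemeasurable_restrict_of_monotoneOn (μ := volume) measurableSet_Ioo
      (betaWeight_monotoneOn hα hα' hβ hαβ)).add
      (Measurable.aemeasurable (f := fun t : ℝ => (1 - α - β) * betaKernel α β 0 * t ^ 2)
        (by fun_prop))
    refine h.congr (.of_forall fun t => ?_)
    simp
  refine (lintegral_ofReal_ne_top_iff_integrable hm.aestronglyMeasurable
    ((ae_restrict_iff' measurableSet_Ioo).2
      (.of_forall fun t ht => (betaWeight_pos hα hα' hβ ht).le))).1 ?_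
  have := lintegral_pow_mul_betaWeight hα hα' hβ 0
  simp only [pow_zero, one_mul] at this
  rw [this]
  exact ENNReal.ofReal_ne_top

lemma integral_pow_mul_betaWeight (hα : 0 < α) (hα' : α < 1 / 2) (hβ : 0 < β) (hαβ : α + β < 1)
    (m : ℕ) :
    ∫ t in Ioo (0 : ℝ) 1, t ^ m * betaWeight α β t =
      ProbabilityTheory.beta ((m + 1) / 2) α *
        ProbabilityTheory.beta ((m + 1) / 2 + 1 / 2) β / 2 := by
  have hnn : ∀ t ∈ Ioo (0 : ℝ) 1, 0 ≤ t ^ m * betaWeight α β t := fun t ht =>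
    mul_nonneg (pow_nonneg ht.1.le m) (betaWeight_pos hα hα' hβ ht).le
  have hi : IntegrableOn (fun t => t ^ m * betaWeight α β t) (Ioo 0 1) := by
    simp_rw [mul_comm _ (betaWeight α β _)]
    exact (betaWeight_integrableOn hα hα' hβ hαβ).mul_continuous_Ioo (by fun_prop)
  have h1 := ofReal_integral_eq_lintegral_ofReal hi
    ((ae_restrict_iff' measurableSet_Ioo).2 (.of_forall hnn))
  rw [lintegral_pow_mul_betaWeight hα hα' hβ] at h1
  have hb1 := ProbabilityTheory.beta_pos (α := ((m : ℝ) + 1) / 2) (by positivity) hα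
  have hb2 := ProbabilityTheory.beta_pos (α := ((m : ℝ) + 1) / 2 + 1 / 2) (by positivity) hβ
  exact (ENNReal.ofReal_eq_ofReal_iff (setIntegral_nonneg measurableSet_Ioo hnn)
    (by positivity)).1 h1

lemma isIncreasingWeight_const_mul_betaWeight (hα : 0 < α) (hα' : α < 1 / 2) (hβ : 0 < β)
    (hαβ : α + β < 1) {N : ℝ} (hN : 0 < N) :
    IsIncreasingWeight (fun t => N * betaWeight α β t)
      (N * ((1 - α - β) * betaKernel α β 0)) where
  pos := mul_pos hN (mul_pos (by linarith) (betaKernel_zero_pos hα hα' hβ))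
  integrableOn := (betaWeight_integrableOn hα hα' hβ hαβ).const_mul N
  monotoneOn s hs t ht hst := by
    have := mul_le_mul_of_nonneg_left (betaWeight_monotoneOn hα hα' hβ hαβ hs ht hst) hN.le
    simp only at this ⊢
    linarith
  le t ht := by
    have := mul_le_mul_of_nonneg_left (betaWeight_ge hα hα' hβ hαβ ht) hN.le
    linarith

end betaKernel

/-! ### Power series of the cosine and sine integrals -/

/-- Termwise integration of a power series against an integrable weight on `(0, 1)`. -/
lemma hasSum_mul_moment {f : ℝ → ℝ} (hf : IntegrableOn f (Ioo 0 1)) {d : ℕ → ℂ} (e : ℕ → ℕ)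
    (hd : Summable fun n => ‖d n‖) {φ : ℝ → ℂ}
    (hφ : ∀ t : ℝ, HasSum (fun n => d n * (t : ℂ) ^ e n) (φ t)) :
    HasSum (fun n => d n * ((∫ t in Ioo (0 : ℝ) 1, t ^ e n * f t : ℝ) : ℂ))
      (∫ t in Ioo (0 : ℝ) 1, (f t : ℂ) * φ t) := by
  have hi : ∀ n, IntegrableOn (fun t => (f t : ℂ) * (d n * (t : ℂ) ^ e n)) (Ioo 0 1) :=
    fun n => hf.ofReal_mul_continuous_Ioo (by fun_prop)
  have h := hasSum_integral_of_summable_integral_norm hi (by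
    refine Summable.of_nonneg_of_le (fun n => integral_nonneg fun t => norm_nonneg _) (fun n => ?_)
      (hd.mul_right (∫ t in Ioo (0 : ℝ) 1, |f t|))
    rw [← integral_const_mul]
    refine setIntegral_mono_on (hi n).norm (hf.abs.const_mul _) measurableSet_Ioo fun t ht => ?_
    rw [norm_mul, norm_mul, Complex.norm_real, Real.norm_eq_abs, norm_pow, Complex.norm_real,
      Real.norm_of_nonneg ht.1.le, mul_comm]
    exact mul_le_mul_of_nonneg_right
      (mul_le_of_le_one_right (norm_nonneg _) (pow_le_one₀ ht.1.le ht.2.le)) (abs_nonneg _))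
  have e1 : ∀ t, ∑' n, (f t : ℂ) * (d n * (t : ℂ) ^ e n) = (f t : ℂ) * φ t := fun t =>
    ((hφ t).mul_left _).tsum_eq
  simp_rw [e1] at h
  refine h.congr_fun fun n => ?_
  rw [← integral_complex_ofReal, ← integral_const_mul]
  congr 1
  ext t
  push_cast
  ring

lemma hasSum_integral_mul_cos {f : ℝ → ℝ} (hf : IntegrableOn f (Ioo 0 1)) (z : ℂ) :
    HasSum (fun n : ℕ => (-1) ^ n * z ^ (2 * n) / ((2 * n).factorial : ℂ) *
        ((∫ t in Ioo (0 : ℝ) 1, t ^ (2 * n) * f t : ℝ) : ℂ))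
      (∫ t in Ioo (0 : ℝ) 1, (f t : ℂ) * Complex.cos (z * t)) := by
  refine hasSum_mul_moment hf (fun n => 2 * n) ?_ fun t => ?_
  · have h := (Real.summable_pow_div_factorial ‖z‖).comp_injective
      (i := fun n : ℕ => 2 * n) (mul_right_injective₀ two_ne_zero)
    simpa [Function.comp_def] using h
  · refine (Complex.hasSum_cos (z * t)).congr_fun fun n => ?_
    rw [mul_pow]
    ring

lemma hasSum_integral_mul_sin {f : ℝ → ℝ} (hf : IntegrableOn f (Ioo 0 1)) (z : ℂ) :
    HasSum (fun n : ℕ => (-1) ^ n * z ^ (2 * n + 1) / ((2 * n + 1).factorial : ℂ) *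
        ((∫ t in Ioo (0 : ℝ) 1, t ^ (2 * n + 1) * f t : ℝ) : ℂ))
      (∫ t in Ioo (0 : ℝ) 1, (f t : ℂ) * Complex.sin (z * t)) := by
  refine hasSum_mul_moment hf (fun n => 2 * n + 1) ?_ fun t => ?_
  · have h := (Real.summable_pow_div_factorial ‖z‖).comp_injective
      (i := fun n : ℕ => 2 * n + 1) (fun a b h => by simpa using h)
    simpa [Function.comp_def] using h
  · refine (Complex.hasSum_sin (z * t)).congr_fun fun n => ?_
    rw [mul_pow]
    ring

lemma cosTransform_eq_cos_add_sin {f : ℝ → ℝ} (hf : IntegrableOn f (Ioo 0 1)) (θ : ℝ) (z : ℂ) :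
    cosTransform f θ z =
      Real.cos θ * (∫ t in Ioo (0 : ℝ) 1, (f t : ℂ) * Complex.cos (z * t)) +
      Real.sin θ * ∫ t in Ioo (0 : ℝ) 1, (f t : ℂ) * Complex.sin (z * t) := by
  rw [cosTransform, ← integral_const_mul, ← integral_const_mul,
    ← integral_add ((hf.ofReal_mul_continuous_Ioo (by fun_prop)).const_mul _)
      ((hf.ofReal_mul_continuous_Ioo (by fun_prop)).const_mul _)]
  congr 1
  ext t
  rw [Complex.cos_sub]
  push_cast
  ring

lemma beta_add_one_left {s a : ℝ} (hs : 0 < s) (ha : 0 < a) :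
    ProbabilityTheory.beta (s + 1) a * (s + a) = s * ProbabilityTheory.beta s a := by
  have h := (Real.Gamma_pos_of_pos (add_pos hs ha)).ne'
  have h2 : s + a ≠ 0 := (add_pos hs ha).ne'
  rw [ProbabilityTheory.beta, ProbabilityTheory.beta, Real.Gamma_add_one hs.ne',
    show s + 1 + a = s + a + 1 by ring, Real.Gamma_add_one h2]
  field_simp

/-! ### The Lommel weight and its moments -/

/-- The weight whose cosine transform is the Lommel combination. -/
noncomputable def lommelWeight (μ ν t : ℝ) : ℝ :=
  Real.Gamma ((μ + 1 + ν) / 2) / (√Real.pi * Real.Gamma ((μ + ν) / 2)) *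
    betaWeight ((μ + 1 - ν) / 2) ((μ + ν) / 2) t

section lommel

variable {μ ν : ℝ}

/-- With `α = (μ + 1 - ν)/2` and `β = (μ + ν)/2`, the parameter range translates exactly: `α > 0` is
`ν < μ + 1`, `α < 1/2` is `μ < ν`, `β > 0` is `-μ < ν`, and `α + β < 1` is `μ < 1/2`. -/
lemma lommelWeight_isIncreasingWeight (hμ : μ < 1 / 2) (hν : |μ| < ν) (hν' : ν < μ + 1) :
    ∃ c, IsIncreasingWeight (lommelWeight μ ν) c := by
  have h := abs_lt.1 hν
  exact ⟨_, isIncreasingWeight_const_mul_betaWeight (by linarith) (by linarith) (by linarith)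
    (by linarith) (div_pos (Real.Gamma_pos_of_pos (by linarith [abs_nonneg μ]))
      (mul_pos (Real.sqrt_pos.2 Real.pi_pos) (Real.Gamma_pos_of_pos (by linarith))))⟩

lemma integral_pow_mul_lommelWeight (hμ : μ < 1 / 2) (hν : |μ| < ν) (hν' : ν < μ + 1) (m : ℕ) :
    ∫ t in Ioo (0 : ℝ) 1, t ^ m * lommelWeight μ ν t =
      Real.Gamma ((μ + 1 + ν) / 2) / (√Real.pi * Real.Gamma ((μ + ν) / 2)) *
        (ProbabilityTheory.beta ((m + 1) / 2) ((μ + 1 - ν) / 2) *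
          ProbabilityTheory.beta ((m + 1) / 2 + 1 / 2) ((μ + ν) / 2) / 2) := by
  have h := abs_lt.1 hν
  rw [← integral_pow_mul_betaWeight (by linarith) (by linarith) (by linarith) (by linarith),
    ← integral_const_mul]
  congr 1
  ext t
  rw [lommelWeight]
  ring

/-- Raising `m` by `2` raises both beta arguments by `1`. The resulting denominators `(m + 2 + μ -
ν)/2` and `(m + 2 + μ + ν)/2` multiply to a factor of the Lommel series, and the numerators give the
factorial step. -/
lemma lommelWeight_moment_rec (hμ : μ < 1 / 2) (hν : |μ| < ν) (hν' : ν < μ + 1) (m : ℕ) :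
    (∫ t in Ioo (0 : ℝ) 1, t ^ (m + 2) * lommelWeight μ ν t) * ((μ + m + 2) ^ 2 - ν ^ 2) =
      (m + 1) * (m + 2) * ∫ t in Ioo (0 : ℝ) 1, t ^ m * lommelWeight μ ν t := by
  have h := abs_lt.1 hν
  rw [integral_pow_mul_lommelWeight hμ hν hν', integral_pow_mul_lommelWeight hμ hν hν']
  have h1 := beta_add_one_left (s := ((m : ℝ) + 1) / 2) (a := (μ + 1 - ν) / 2) (by positivity)
    (by linarith)
  have h2 := beta_add_one_left (s := ((m : ℝ) + 1) / 2 + 1 / 2) (a := (μ + ν) / 2) (by positivity)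
    (by linarith)
  have e1 : (((m + 2 : ℕ) : ℝ) + 1) / 2 = ((m : ℝ) + 1) / 2 + 1 := by
    push_cast
    ring
  rw [e1, show ((m : ℝ) + 1) / 2 + 1 + 1 / 2 = ((m : ℝ) + 1) / 2 + 1 / 2 + 1 by ring]
  set N := Real.Gamma ((μ + 1 + ν) / 2) / (√Real.pi * Real.Gamma ((μ + ν) / 2))
  generalize ProbabilityTheory.beta (((m : ℝ) + 1) / 2 + 1) ((μ + 1 - ν) / 2) = b1 at *
  generalize ProbabilityTheory.beta (((m : ℝ) + 1) / 2 + 1 / 2 + 1) ((μ + ν) / 2) = b2 at *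
  generalize ProbabilityTheory.beta (((m : ℝ) + 1) / 2) ((μ + 1 - ν) / 2) = b3 at *
  generalize ProbabilityTheory.beta (((m : ℝ) + 1) / 2 + 1 / 2) ((μ + ν) / 2) = b4 at *
  linear_combination (2 * N * b2 * (((m : ℝ) + 1) / 2 + 1 / 2 + (μ + ν) / 2)) * h1 +
    (2 * N * b3 * (((m : ℝ) + 1) / 2)) * h2

lemma beta_one_left {a : ℝ} (ha : 0 < a) : ProbabilityTheory.beta 1 a = 1 / a := by
  have := (Real.Gamma_pos_of_pos ha).ne'
  rw [ProbabilityTheory.beta, Real.Gamma_one, add_comm, Real.Gamma_add_one ha.ne']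
  field_simp

lemma lommelWeight_moment_zero (hμ : μ < 1 / 2) (hν : |μ| < ν) (hν' : ν < μ + 1) :
    (∫ t in Ioo (0 : ℝ) 1, t ^ 0 * lommelWeight μ ν t) * (μ ^ 2 - ν ^ 2) = lommelA μ ν := by
  have h := abs_lt.1 hν
  rw [integral_pow_mul_lommelWeight hμ hν hν', lommelA, Nat.cast_zero, zero_add,
    show (1 : ℝ) / 2 + 1 / 2 = 1 by norm_num, beta_one_left (by linarith),
    ProbabilityTheory.beta, Real.Gamma_one_half_eq,
    show 1 / 2 + (μ + 1 - ν) / 2 = (μ - ν) / 2 + 1 by ring,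
    Real.Gamma_add_one (by linarith)]
  have h1 : Real.Gamma ((μ + ν) / 2) ≠ 0 := (Real.Gamma_pos_of_pos (by linarith)).ne'
  -- The argument is negative but greater than `-1/2`, so nonvanishing follows from the functional
  -- equation.
  have h2 : Real.Gamma ((μ - ν) / 2) ≠ 0 := by
    have h3 : 0 < Real.Gamma ((μ - ν) / 2 + 1) := Real.Gamma_pos_of_pos (by linarith)
    rw [Real.Gamma_add_one (by linarith)] at h3
    exact fun h0 => by simp [h0] at h3
  have h3 : √Real.pi ≠ 0 := (Real.sqrt_pos.2 Real.pi_pos).ne'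
  have h4 : μ + ν ≠ 0 := by linarith
  have h5 : μ - ν ≠ 0 := by linarith
  field_simp
  ring

/-- The constant in `lommelWeight` is the normalisation that makes the right side `1`; the zeroth
moment is then forced to produce `lommelA`. -/
lemma lommelWeight_moment_one (hμ : μ < 1 / 2) (hν : |μ| < ν) (hν' : ν < μ + 1) :
    (∫ t in Ioo (0 : ℝ) 1, t ^ 1 * lommelWeight μ ν t) * ((μ + 1) ^ 2 - ν ^ 2) = 1 := by
  have h := abs_lt.1 hν
  rw [integral_pow_mul_lommelWeight hμ hν hν', Nat.cast_one,
    show ((1 : ℝ) + 1) / 2 = 1 by norm_num, beta_one_left (by linarith),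
    ProbabilityTheory.beta, show (1 : ℝ) + 1 / 2 = 1 / 2 + 1 by norm_num,
    Real.Gamma_add_one (by norm_num), Real.Gamma_one_half_eq,
    show 1 / 2 + 1 + (μ + ν) / 2 = (μ + 1 + ν) / 2 + 1 by ring,
    Real.Gamma_add_one (by linarith [abs_nonneg μ])]
  have h1 : Real.Gamma ((μ + ν) / 2) ≠ 0 := (Real.Gamma_pos_of_pos (by linarith)).ne'
  have h2 : Real.Gamma ((μ + 1 + ν) / 2) ≠ 0 :=
    (Real.Gamma_pos_of_pos (by linarith [abs_nonneg μ])).ne'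
  have h3 : √Real.pi ≠ 0 := (Real.sqrt_pos.2 Real.pi_pos).ne'
  have h4 : μ + 1 + ν ≠ 0 := by linarith
  have h5 : μ + 1 - ν ≠ 0 := by linarith
  field_simp
  ring

lemma lommelWeight_moment_even (hμ : μ < 1 / 2) (hν : |μ| < ν) (hν' : ν < μ + 1) (n : ℕ) :
    (∫ t in Ioo (0 : ℝ) 1, t ^ (2 * n) * lommelWeight μ ν t) *
      ∏ j ∈ Finset.range (n + 1), ((μ + 2 * (j : ℝ)) ^ 2 - ν ^ 2) =
      lommelA μ ν * ((2 * n).factorial : ℝ) := by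
  induction n with
  | zero => simpa using lommelWeight_moment_zero hμ hν hν'
  | succ n ih =>
    have h := lommelWeight_moment_rec hμ hν hν' (2 * n)
    rw [Finset.prod_range_succ, show 2 * (n + 1) = 2 * n + 2 by ring, Nat.factorial_succ,
      Nat.factorial_succ]
    push_cast at h ih ⊢
    linear_combination (∏ j ∈ Finset.range (n + 1), ((μ + 2 * (j : ℝ)) ^ 2 - ν ^ 2)) * h +
      ((2 * (n : ℝ) + 1) * (2 * n + 2)) * ih

lemma lommelWeight_moment_odd (hμ : μ < 1 / 2) (hν : |μ| < ν) (hν' : ν < μ + 1) (n : ℕ) :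
    (∫ t in Ioo (0 : ℝ) 1, t ^ (2 * n + 1) * lommelWeight μ ν t) *
      ∏ j ∈ Finset.range (n + 1), ((μ + 2 * (j : ℝ) + 1) ^ 2 - ν ^ 2) =
      ((2 * n + 1).factorial : ℝ) := by
  induction n with
  | zero => simpa using lommelWeight_moment_one hμ hν hν'
  | succ n ih =>
    have h := lommelWeight_moment_rec hμ hν hν' (2 * n + 1)
    rw [Finset.prod_range_succ, show 2 * (n + 1) + 1 = 2 * n + 1 + 2 by ring, Nat.factorial_succ,
      Nat.factorial_succ]
    push_cast at h ih ⊢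
    linear_combination (∏ j ∈ Finset.range (n + 1), ((μ + 2 * (j : ℝ) + 1) ^ 2 - ν ^ 2)) * h +
      ((2 * (n : ℝ) + 1 + 1) * (2 * n + 1 + 2)) * ih

lemma prod_even_ne_zero (hν : |μ| < ν) (hν' : ν < μ + 1) (n : ℕ) :
    ∏ j ∈ Finset.range n, ((μ + 2 * (j : ℝ)) ^ 2 - ν ^ 2) ≠ 0 := by
  have h := abs_lt.1 hν
  refine Finset.prod_ne_zero_iff.2 fun j _ => ?_
  rw [sq_sub_sq]
  -- The factor `μ + 2j - ν` is negative for `j = 0` and positive afterwards.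
  rcases j with _ | j
  · exact mul_ne_zero (by push_cast; linarith) (by push_cast; linarith)
  · have : (0 : ℝ) ≤ j := j.cast_nonneg
    exact mul_ne_zero (by push_cast; linarith) (by push_cast; linarith)

lemma prod_odd_ne_zero (hν : |μ| < ν) (hν' : ν < μ + 1) (n : ℕ) :
    ∏ j ∈ Finset.range n, ((μ + 2 * (j : ℝ) + 1) ^ 2 - ν ^ 2) ≠ 0 := by
  have h := abs_lt.1 hν
  refine Finset.prod_ne_zero_iff.2 fun j _ => ?_
  have : (0 : ℝ) ≤ j := j.cast_nonneg
  rw [sq_sub_sq]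
  exact mul_ne_zero (by linarith) (by linarith)

/-- Each `(2n)!` from the moments cancels the cosine coefficient; the index `μ - 1` matches because
`(μ - 1) + 2j + 1 = μ + 2j`. -/
lemma integral_lommelWeight_mul_cos (hμ : μ < 1 / 2) (hν : |μ| < ν) (hν' : ν < μ + 1) (z : ℂ) :
    ∫ t in Ioo (0 : ℝ) 1, (lommelWeight μ ν t : ℂ) * Complex.cos (z * t) =
      lommelA μ ν * ∑' n : ℕ, (-1) ^ n * z ^ (2 * n) /
        ∏ j ∈ Finset.range (n + 1), ((((μ - 1 : ℝ) : ℂ) + 2 * (j : ℂ) + 1) ^ 2 - (ν : ℂ) ^ 2) := by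
  obtain ⟨c, hf⟩ := lommelWeight_isIncreasingWeight hμ hν hν'
  rw [← (hasSum_integral_mul_cos hf.integrableOn z).tsum_eq, ← tsum_mul_left]
  congr 1
  ext n
  have h := congrArg (fun x : ℝ => (x : ℂ)) (lommelWeight_moment_even hμ hν hν' n)
  have hne : ((∏ j ∈ Finset.range (n + 1), ((μ + 2 * (j : ℝ)) ^ 2 - ν ^ 2) : ℝ) : ℂ) ≠ 0 :=
    Complex.ofReal_ne_zero.2 (prod_even_ne_zero hν hν' (n + 1))
  have e : ∏ j ∈ Finset.range (n + 1),
      ((((μ - 1 : ℝ) : ℂ) + 2 * (j : ℂ) + 1) ^ 2 - (ν : ℂ) ^ 2) =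
      ((∏ j ∈ Finset.range (n + 1), ((μ + 2 * (j : ℝ)) ^ 2 - ν ^ 2) : ℝ) : ℂ) := by
    push_cast
    refine Finset.prod_congr rfl fun j _ => ?_
    ring
  have hfac : ((2 * n).factorial : ℂ) ≠ 0 := Nat.cast_ne_zero.2 (Nat.factorial_ne_zero _)
  rw [e]
  simp only [Complex.ofReal_mul, Complex.ofReal_natCast] at h
  field_simp
  linear_combination z ^ (2 * n) * h

lemma integral_lommelWeight_mul_sin (hμ : μ < 1 / 2) (hν : |μ| < ν) (hν' : ν < μ + 1) (z : ℂ) :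
    ∫ t in Ioo (0 : ℝ) 1, (lommelWeight μ ν t : ℂ) * Complex.sin (z * t) =
      z * ∑' n : ℕ, (-1) ^ n * z ^ (2 * n) /
        ∏ j ∈ Finset.range (n + 1), (((μ : ℂ) + 2 * (j : ℂ) + 1) ^ 2 - (ν : ℂ) ^ 2) := by
  obtain ⟨c, hf⟩ := lommelWeight_isIncreasingWeight hμ hν hν'
  rw [← (hasSum_integral_mul_sin hf.integrableOn z).tsum_eq, ← tsum_mul_left]
  congr 1
  ext n
  have h := congrArg (fun x : ℝ => (x : ℂ)) (lommelWeight_moment_odd hμ hν hν' n)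
  have hne : ((∏ j ∈ Finset.range (n + 1), ((μ + 2 * (j : ℝ) + 1) ^ 2 - ν ^ 2) : ℝ) : ℂ) ≠ 0 :=
    Complex.ofReal_ne_zero.2 (prod_odd_ne_zero hν hν' (n + 1))
  have e : ∏ j ∈ Finset.range (n + 1), (((μ : ℂ) + 2 * (j : ℂ) + 1) ^ 2 - (ν : ℂ) ^ 2) =
      ((∏ j ∈ Finset.range (n + 1), ((μ + 2 * (j : ℝ) + 1) ^ 2 - ν ^ 2) : ℝ) : ℂ) := by
    push_cast
    rfl
  have hfac : ((2 * n + 1).factorial : ℂ) ≠ 0 := Nat.cast_ne_zero.2 (Nat.factorial_ne_zero _)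
  rw [e]
  simp only [Complex.ofReal_mul, Complex.ofReal_natCast] at h
  field_simp
  linear_combination z ^ (2 * n + 1) * h

lemma cosTransform_lommelWeight (hμ : μ < 1 / 2) (hν : |μ| < ν) (hν' : ν < μ + 1) (θ : ℝ) {z : ℂ}
    (hz : z ≠ 0) : cosTransform (lommelWeight μ ν) θ z = lommelComb μ ν θ z := by
  obtain ⟨c, hf⟩ := lommelWeight_isIncreasingWeight hμ hν hν'
  rw [cosTransform_eq_cos_add_sin hf.integrableOn, integral_lommelWeight_mul_cos hμ hν hν',
    integral_lommelWeight_mul_sin hμ hν hν', lommelComb, lommelS, lommelS]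
  have h1 : z ^ (-(μ : ℂ)) * z ^ (((μ - 1 : ℝ) : ℂ) + 1) = 1 := by
    rw [← Complex.cpow_add _ _ hz]
    push_cast
    simp
  have h2 : z ^ (-(μ : ℂ)) * z ^ ((μ : ℂ) + 1) = z := by
    rw [← Complex.cpow_add _ _ hz]
    simp
  rw [Complex.ofReal_mul]
  generalize (∑' n : ℕ, (-1) ^ n * z ^ (2 * n) / ∏ j ∈ Finset.range (n + 1),
    ((((μ - 1 : ℝ) : ℂ) + 2 * (j : ℂ) + 1) ^ 2 - (ν : ℂ) ^ 2)) = S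
  generalize (∑' n : ℕ, (-1) ^ n * z ^ (2 * n) /
    ∏ j ∈ Finset.range (n + 1), (((μ : ℂ) + 2 * (j : ℂ) + 1) ^ 2 - (ν : ℂ) ^ 2)) = T
  linear_combination (-(lommelA μ ν : ℂ) * (Real.cos θ : ℂ) * S) * h1 - ((Real.sin θ : ℂ) * T) * h2

/-- Everything is even in `ν`: the series involves `ν²`, and `lommelA` is symmetric in its Gamma
factors. This reduces the theorem to positive `ν`. -/
lemma lommelComb_abs (μ ν θ : ℝ) (z : ℂ) : lommelComb μ |ν| θ z = lommelComb μ ν θ z := by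
  rcases abs_choice ν with h | h <;> rw [h]
  have hA : lommelA μ (-ν) = lommelA μ ν := by
    simp only [lommelA, sub_neg_eq_add, ← sub_eq_add_neg]
    ring
  simp only [lommelComb, lommelS, hA, Complex.ofReal_neg, neg_sq]

end lommel

end

theorem mainTheorem9 (μ ν θ : ℝ) (hμ : μ ∈ Set.Ioo (-(1 / 2) : ℝ) (1 / 2))
    (hν : |ν| ∈ Set.Ioo |μ| (μ + 1)) (hθ : θ ∈ Set.Icc 0 Real.pi) :
    -- the combination extends to an entire function `F`, whose zeros are considered
    ∃ F : ℂ → ℂ, Differentiable ℂ F ∧ (∀ z : ℂ, z ≠ 0 → F z = lommelComb μ ν θ z) ∧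
      -- all zeros are real and simple
      (∀ z : ℂ, F z = 0 → z.im = 0 ∧ deriv F z ≠ 0) ∧
      -- every zero other than the origin lies in one of the open intervals
      (∀ x : ℝ, x ≠ 0 → F (x : ℂ) = 0 →
        ∃ k : ℤ, x ∈ Set.Ioo (zeroEndpoint θ k) (zeroEndpoint θ (k + 1))) ∧
      (F 0 = 0 ↔ θ = Real.pi / 2) ∧
      -- exactly one zero in each interval whose closure does not contain the origin
      (∀ k : ℤ, (0 : ℝ) ∉ Set.Icc (zeroEndpoint θ k) (zeroEndpoint θ (k + 1)) →
        ∃! x : ℝ, x ∈ Set.Ioo (zeroEndpoint θ k) (zeroEndpoint θ (k + 1)) ∧ F (x : ℂ) = 0) ∧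
      -- no zero in an interval whose closure contains the origin
      (∀ k : ℤ, (0 : ℝ) ∈ Set.Icc (zeroEndpoint θ k) (zeroEndpoint θ (k + 1)) →
        ∀ x : ℝ, x ∈ Set.Ioo (zeroEndpoint θ k) (zeroEndpoint θ (k + 1)) → F (x : ℂ) ≠ 0) := by
  obtain ⟨c, hf⟩ := lommelWeight_isIncreasingWeight hμ.2 hν.1 hν.2
  refine ⟨cosTransform (lommelWeight μ |ν|) θ, differentiable_cosTransform hf.integrableOn θ,
    fun z hz => ?_, fun z hz => ?_, fun x hx0 hx => hf.exists_mem_Ioo θ hx0 hx,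
    hf.cosTransform_zero_eq_zero_iff hθ, fun k hk => hf.existsUnique_zero θ hk,
    fun k hk x hx => hf.ne_zero_of_zero_mem θ hk hx⟩
  · rw [cosTransform_lommelWeight hμ.2 hν.1 hν.2 θ hz, lommelComb_abs]
  · have him := hf.im_eq_zero θ hz
    have e : z = (z.re : ℂ) := Complex.ext rfl (by simpa using him)
    rw [e] at hz
    refine ⟨him, ?_⟩
    rw [e]
    exact hf.deriv_ne_zero θ hz
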